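/- Let $\Gamma=\{1,\dots,m\}$, let $f_\gamma:\mathbb R^n\to\mathbb R^n$ ($\gamma\in\Gamma$) be continuous, and write $f(\xi,\gamma)=f_\gamma(\xi)$. A switching signal is a right-continuous, piecewise constant function $\sigma:[0,\infty)\to\Gamma$, with switching times $t_0=0<t_1<t_2<\cdots$, where $t_1,t_2,\dots$ are its discontinuities, finitely many in every bounded interval. A trajectory $(x,\sigma)$ of $\dot x=f(x,\sigma)$ consists of a switching signal $\sigma$ and a continuous curve $x:I\to\mathbb R^n$, $I=[0,T)$ or $[0,T]$, $T>0$ (also $I=[0,\infty)$), with $\dot x(t)=f_{\sigma(t)}(x(t))$ for all $t\in I$ that are not switching times; it is maximal if $x$ has no proper extension to a solution for the same $\sigma$. Let $\chi=\{\chi_\gamma\}_{\gamma\in\Gamma}$ be closed sets with $\bigcup_\gamma\chi_\gamma=\mathbb R^n$, and suppose that $f_\gamma(0)=0$ whenever $0\in\chi_\gamma$. For $\tau_D>0$ and $N_0\in\mathbb N$ let $\mathcal T_a[\tau_D,N_0]$ be the set of maximal trajectories $(x,\sigma)$ such that every interval $(a,b)$, $0\le a<b<\infty$, contains at most $N_0+(b-a)/\tau_D$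 switching times of $\sigma$, and let $\mathcal T_a=\bigcup_{\tau_D>0,\,N_0>0}\mathcal T_a[\tau_D,N_0]$. Let $\mathcal T'\subseteq\mathcal T_a$ be a family of maximal trajectories such that $x(t)\in\chi_{\sigma(t)}$ for all $(x,\sigma)\in\mathcal T'$ and all $t$ in the domain of $x$. A function $\alpha:[0,\infty)\to[0,\infty)$ is of class $\mathcal K_\infty$ if it is continuous, strictly increasing and unbounded with $\alpha(0)=0$; $\beta:[0,\infty)^2\to[0,\infty)$ is of class $\mathcal{KL}$ if $\beta(\cdot,t)\in\mathcal K_\infty$ for every $t$ and $\beta(r,\cdot)$ decreases to $0$ for every $r$. Suppose that there is a weak Lyapunov-like function $V:\mathbb R^n\times\Gamma\to\mathbb R$ for $\mathcal T'$, that is, $V(\cdot,\gamma)$ is continuously differentiable for each $\gamma$ and 1. there are $\alpha_1,\alpha_2\in\mathcal K_\infty$ with $\alpha_1(|\xi|)\le V(\xi,\gamma)\le\alpha_2(|\xi|)$ whenever $\xi\in\chi_\gamma$; 2. $\frac{\partial V}{\partial\xi}(\xi,\gamma)f(\xi,\gamma)\le 0$ whenever $\xi\in\chi_\gamma$; 3.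 for all $(x,\sigma)\in\mathcal T'$ and all switching times $t_i<t_j$ (in the domain of $x$, and $t_0=0$ included) with $\sigma(t_i)=\sigma(t_j)$, $V(x(t_j),\sigma(t_j))\le V(x(t_{i+1}),\sigma(t_i))$. Suppose in addition that there are continuous functions $W_\gamma:\mathbb R^n\to[0,\infty)$, $\gamma\in\Gamma$, such that (i) $\frac{\partial V}{\partial\xi}(\xi,\gamma)f(\xi,\gamma)\le -W_\gamma(\xi)$ whenever $\xi\in\chi_\gamma$; (ii) for each $\gamma\in\Gamma$ the system $\dot x=f_\gamma(x)$, $y=W_\gamma(x)$ is zero small-time distinguishable: for every $\delta>0$ and every solution $x$ of $\dot x=f_\gamma(x)$ on $[0,\delta)$ with $W_\gamma(x(t))=0$ for all $t\in[0,\delta)$, one has $x(0)=0$. Then $\mathcal T'$ is globally asymptotically stable: every $(x,\sigma)\in\mathcal T'$ is defined on $[0,\infty)$ and satisfies $x(t)\to0$ as $t\to\infty$, and there is $\alpha\in\mathcal K_\infty$ such that $|x(t)|\le\alpha(|x(t_0)|)$ for all $(x,\sigma)\in\mathcal T'$ and all $t\ge t_0\ge0$. If, in addition, $\mathcal T'\subseteq\mathcal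 T_a[\tau_D,N_0]$ for some $\tau_D>0$ and $N_0\in\mathbb N$, then $\mathcal T'$ is globally uniformly asymptotically stable: there is $\beta\in\mathcal{KL}$ such that $|x(t)|\le\beta(|x(t_0)|,t-t_0)$ for all $(x,\sigma)\in\mathcal T'$ and all $t\ge t_0\ge0$. -/

import Mathlib

open Set Filter Topology
open scoped NNReal

namespace SwitchedSystem

/-- Class `𝒦_∞`: strictly increasing, continuous, zero at zero, unbounded. -/
structure IsClassKInfty (α : ℝ≥0 → ℝ≥0) : Prop where
  strictMono : StrictMono α
  continuous : Continuous α
  map_zero : α 0 = 0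
  unbounded : ∀ M : ℝ≥0, ∃ s : ℝ≥0, M < α s

/-- Class `𝒦ℒ`: of class `𝒦_∞` in the first argument (for every value of the second one), and
decreasing to zero in the second argument. -/
structure IsClassKL (β : ℝ≥0 → ℝ≥0 → ℝ≥0) : Prop where
  left : ∀ t : ℝ≥0, IsClassKInfty fun r => β r t
  right_antitone : ∀ r : ℝ≥0, Antitone (β r)
  right_tendsto : ∀ r : ℝ≥0, Tendsto (β r) atTop (𝓝 0)

/-- The discontinuities of `σ : [0, ∞) → Γ` with `Γ = {1, …, m}` discrete. A signal is a function
on `ℝ` whose values at negative times are irrelevant; right continuity at `0` is part of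
`IsSwitchingSignal`. -/
def discontinuities {m : ℕ} (σ : ℝ → Fin m) : Set ℝ :=
  {t : ℝ | 0 < t ∧ ¬ ContinuousAt σ t}

/-- The switching times `t₀ = 0 < t₁ < t₂ < …` of `σ`, where `t₁, t₂, …` are its consecutive
discontinuities. -/
def switchingTimes {m : ℕ} (σ : ℝ → Fin m) : Set ℝ :=
  insert 0 (discontinuities σ)

/-- Switching signals: piecewise constant (finitely many discontinuities in bounded time) and
continuous from the right. -/
structure IsSwitchingSignal {m : ℕ} (σ : ℝ → Fin m) : Prop where
  right_continuous : ∀ t : ℝ, 0 ≤ t → ContinuousWithinAt σ (Ici t) t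
  locally_finite : ∀ T : ℝ, (discontinuities σ ∩ Iic T).Finite

/-- The intervals `[0, ∞)`, `[0, T)` and `[0, T]` with `0 < T < ∞`. -/
def IsTimeInterval (I : Set ℝ) : Prop :=
  I = Ici 0 ∨ ∃ T : ℝ, 0 < T ∧ (I = Ico 0 T ∨ I = Icc 0 T)

/-- `x` is a solution on `I` of `ẋ = f(x, σ)`: a curve on `I` that satisfies the differential
equation at all times of `I` other than the switching times (one-sided derivative at a right
end point that belongs to `I`). The values of `x` outside `I` are irrelevant. -/
structure IsSolution {n m : ℕ}
    (f : Fin m → EuclideanSpace ℝ (Fin n) → EuclideanSpace ℝ (Fin n))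
    (σ : ℝ → Fin m) (x : ℝ → EuclideanSpace ℝ (Fin n)) (I : Set ℝ) : Prop where
  interval : IsTimeInterval I
  continuousOn : ContinuousOn x I
  ode : ∀ t ∈ I, t ∉ switchingTimes σ → HasDerivWithinAt x (f (σ t) (x t)) I t

/-- A solution is maximal if it has no proper extension to a solution for the same signal. -/
def IsMaximalSolution {n m : ℕ}
    (f : Fin m → EuclideanSpace ℝ (Fin n) → EuclideanSpace ℝ (Fin n))
    (σ : ℝ → Fin m) (x : ℝ → EuclideanSpace ℝ (Fin n)) (I : Set ℝ) : Prop :=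
  IsSolution f σ x I ∧
    ∀ (y : ℝ → EuclideanSpace ℝ (Fin n)) (J : Set ℝ),
      IsSolution f σ y J → I ⊆ J → EqOn x y I → J = I

/-- A trajectory `(x, σ)` of `ẋ = f(x, σ)`: a switching signal and a corresponding solution
`state`, defined on the interval `dom`. -/
structure Trajectory {n m : ℕ}
    (f : Fin m → EuclideanSpace ℝ (Fin n) → EuclideanSpace ℝ (Fin n)) where
  state : ℝ → EuclideanSpace ℝ (Fin n)
  signal : ℝ → Fin m
  dom : Set ℝ
  isSwitchingSignal : IsSwitchingSignal signal
  isSolution : IsSolution f signal state dom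

section Families

variable {n m : ℕ}

/-- The family `𝒯` of all maximal trajectories. -/
def maximalTrajectories (f : Fin m → EuclideanSpace ℝ (Fin n) → EuclideanSpace ℝ (Fin n)) :
    Set (Trajectory f) :=
  {p | IsMaximalSolution f p.signal p.state p.dom}

/-- `χ` is a closed covering of `ℝⁿ`. -/
structure IsClosedCovering (χ : Fin m → Set (EuclideanSpace ℝ (Fin n))) : Prop where
  closed : ∀ γ, IsClosed (χ γ)
  covers : ⋃ γ, χ γ = univ

/-- The family `𝒯[χ]` of the maximal trajectories with `x(t) ∈ χ_{σ(t)}` throughout. -/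
def coveringTrajectories (f : Fin m → EuclideanSpace ℝ (Fin n) → EuclideanSpace ℝ (Fin n))
    (χ : Fin m → Set (EuclideanSpace ℝ (Fin n))) : Set (Trajectory f) :=
  {p | p ∈ maximalTrajectories f ∧ ∀ t ∈ p.dom, p.state t ∈ χ (p.signal t)}

/-- `σ` has average dwell-time `τD` and chatter bound `N0`. -/
def HasAverageDwellTime (τD : ℝ) (N0 : ℕ) (σ : ℝ → Fin m) : Prop :=
  ∀ a b : ℝ, 0 ≤ a → a < b →
    ((switchingTimes σ ∩ Ioo a b).ncard : ℝ) ≤ N0 + (b - a) / τD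

/-- The family `𝒯_a[τD, N0]`. -/
def dwellTrajectories (f : Fin m → EuclideanSpace ℝ (Fin n) → EuclideanSpace ℝ (Fin n))
    (τD : ℝ) (N0 : ℕ) : Set (Trajectory f) :=
  {p | p ∈ maximalTrajectories f ∧ HasAverageDwellTime τD N0 p.signal}

/-- The family `𝒯_a`, the union of all `𝒯_a[τD, N0]` with `τD > 0` and `N0 > 0`. -/
def averageDwellTrajectories
    (f : Fin m → EuclideanSpace ℝ (Fin n) → EuclideanSpace ℝ (Fin n)) : Set (Trajectory f) :=
  {p | ∃ (τD : ℝ) (N0 : ℕ), 0 < τD ∧ 0 < N0 ∧ p ∈ dwellTrajectories f τD N0}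

variable {f : Fin m → EuclideanSpace ℝ (Fin n) → EuclideanSpace ℝ (Fin n)}

/-- Uniform stability. The estimate is for all `t ≥ t₀ ≥ 0`, so that the trajectories have to be
defined on all of `[0, ∞)`. -/
def UniformlyStable (T' : Set (Trajectory f)) : Prop :=
  ∃ α : ℝ≥0 → ℝ≥0, IsClassKInfty α ∧ ∀ p ∈ T', p.dom = Ici 0 ∧
    ∀ t₀ t : ℝ, 0 ≤ t₀ → t₀ ≤ t → ‖p.state t‖₊ ≤ α ‖p.state t₀‖₊

/-- Global asymptotic stability. -/
def GloballyAsymptoticallyStable (T' : Set (Trajectory f)) : Prop :=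
  UniformlyStable T' ∧ ∀ p ∈ T', Tendsto p.state atTop (𝓝 0)

/-- Global uniform asymptotic stability. -/
def GloballyUniformlyAsymptoticallyStable (T' : Set (Trajectory f)) : Prop :=
  ∃ β : ℝ≥0 → ℝ≥0 → ℝ≥0, IsClassKL β ∧ ∀ p ∈ T', p.dom = Ici 0 ∧
    ∀ t₀ t : ℝ, 0 ≤ t₀ → t₀ ≤ t → ‖p.state t‖₊ ≤ β ‖p.state t₀‖₊ (t - t₀).toNNReal

/-- `V` is a weak Lyapunov-like function for the family `T'`, with respect to the covering `χ`. In
`switching`, `s = t_i`, `s' = t_{i+1}` and `t = t_j`. -/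
structure IsWeakLyapunovLike (χ : Fin m → Set (EuclideanSpace ℝ (Fin n)))
    (T' : Set (Trajectory f)) (V : EuclideanSpace ℝ (Fin n) → Fin m → ℝ) : Prop where
  contDiff : ∀ γ, ContDiff ℝ 1 fun ξ => V ξ γ
  bounds : ∃ α₁ α₂ : ℝ≥0 → ℝ≥0, IsClassKInfty α₁ ∧ IsClassKInfty α₂ ∧
    ∀ γ, ∀ ξ ∈ χ γ, (α₁ ‖ξ‖₊ : ℝ) ≤ V ξ γ ∧ V ξ γ ≤ α₂ ‖ξ‖₊
  decreasing : ∀ γ, ∀ ξ ∈ χ γ, fderiv ℝ (fun η => V η γ) ξ (f γ ξ) ≤ 0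
  switching : ∀ p ∈ T', ∀ s s' t : ℝ,
    s ∈ switchingTimes p.signal → t ∈ switchingTimes p.signal → t ∈ p.dom → s < t →
    IsLeast {r | r ∈ switchingTimes p.signal ∧ s < r} s' → p.signal s = p.signal t →
    V (p.state t) (p.signal t) ≤ V (p.state s') (p.signal s)

end Families

/-- The system `ẋ = g(x)`, `y = w(x)` is zero small-time distinguishable: for every `δ > 0`, every
solution `x` on `[0, δ)` along which the output vanishes starts at `0`. -/
def ZeroSmallTimeDistinguishable {n : ℕ}
    (g : EuclideanSpace ℝ (Fin n) → EuclideanSpace ℝ (Fin n))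
    (w : EuclideanSpace ℝ (Fin n) → ℝ) : Prop :=
  ∀ (δ : ℝ) (x : ℝ → EuclideanSpace ℝ (Fin n)), 0 < δ →
    ContinuousOn x (Ico 0 δ) → (∀ t ∈ Ioo 0 δ, HasDerivAt x (g (x t)) t) →
    (∀ t ∈ Ico 0 δ, w (x t) = 0) → x 0 = 0

end SwitchedSystem

/-! Stability. Let `r` be the first time in `[t₀, t]` at which the mode active at `t` is active. By
the switching condition its Lyapunov function has not grown from `r` to `t` (`le_of_signal_eq`), so
the bounds `α₁`, `α₂` give `|x(t)| ≤ α(|x(r)|)`. Before `r` that mode is absent, so induction on the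
number of modes bounds `|x(t)|` by `m` applications of `α` to `|x(t₀)|`. Bounded maximal solutions
are global, since Peano's theorem continues them past any finite end point.

Attractivity. An average dwell-time puts a switch-free interval of fixed length in every window of
length `τD`. While the trajectory stays in an annulus `δ ≤ |x| ≤ R`, the active Lyapunov function
loses at least a fixed `c > 0` on each such interval (`exists_pos_decrease`): otherwise a limit of
solutions would be a nonzero solution with vanishing output, against distinguishability. No mode
regains its loss between two activations, so each mode affords only boundedly many losses; as there
are `m` modes, the ball of radius `δ` is reached within a time depending only on `δ` and `R`
(`exists_time_norm_lt`).

Together these give a `𝒦ℒ` bound when the dwell constants are common to the family. Convergence of a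
single trajectory is the case of a family with one member. -/

namespace SwitchedSystem

/-! ### Compactness of solution sets and Peano's theorem -/

section Compactness

variable {E : Type*} [NormedAddCommGroup E]

/-- A uniformly bounded sequence of curves with a common Lipschitz constant on a compact interval
has a uniformly convergent subsequence. -/
theorem exists_subseq_tendstoUniformlyOn [ProperSpace E] {x : ℕ → ℝ → E} {a b R : ℝ} {M : ℝ≥0}
    (hx : ∀ k, LipschitzOnWith M (x k) (Icc a b)) (hR : ∀ k, ∀ t ∈ Icc a b, ‖x k t‖ ≤ R) :
    ∃ (φ : ℕ → ℕ) (y : ℝ → E), StrictMono φ ∧ ContinuousOn y (Icc a b) ∧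
      TendstoUniformlyOn (fun k => x (φ k)) y atTop (Icc a b) := by
  let F : ℕ → BoundedContinuousFunction (Icc a b) E := fun k =>
    BoundedContinuousFunction.mkOfCompact
      ⟨(Icc a b).domRestrict (x k), (hx k).continuousOn.domRestrict⟩
  have hF : IsCompact (closure (range F)) := by
    refine BoundedContinuousFunction.arzela_ascoli (Metric.closedBall 0 R)
      (isCompact_closedBall 0 R) _ ?_ ?_
    · rintro _ t ⟨k, rfl⟩
      exact mem_closedBall_zero_iff.2 (hR k t t.2)
    · refine UniformEquicontinuous.equicontinuous (LipschitzWith.uniformEquicontinuous _ M ?_)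
      rintro ⟨_, k, rfl⟩
      exact (hx k).to_restrict
  obtain ⟨y, -, φ, hφ, hy⟩ := hF.tendsto_subseq fun k => subset_closure (mem_range_self k)
  rw [BoundedContinuousFunction.tendsto_iff_tendstoUniformly] at hy
  by_cases hab : a ≤ b
  · have hext : ∀ t : Icc a b, IccExtend hab y t = y t := fun t => IccExtend_val hab y t
    refine ⟨φ, IccExtend hab y, hφ, y.continuous.Icc_extend'.continuousOn, ?_⟩
    rw [tendstoUniformlyOn_iff_tendstoUniformly_comp_coe]
    have : (IccExtend hab y) ∘ ((↑) : Icc a b → ℝ) = y := funext hext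
    rw [this]
    exact hy
  · simp only [Icc_eq_empty hab]
    exact ⟨φ, 0, hφ, continuousOn_empty _, tendstoUniformlyOn_empty⟩

variable [NormedSpace ℝ E]

theorem lipschitzOnWith_Icc_of_hasDerivAt {x v : ℝ → E} {a b : ℝ} {M : ℝ≥0} (hab : a < b)
    (hc : ContinuousOn x (Icc a b)) (hd : ∀ t ∈ Ioo a b, HasDerivAt x (v t) t)
    (hv : ∀ t ∈ Ioo a b, ‖v t‖ ≤ M) : LipschitzOnWith M x (Icc a b) := by
  rw [← closure_Ioo hab.ne] at hc ⊢
  refine LipschitzOnWith.closure hc ?_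
  refine (convex_Ioo a b).lipschitzOnWith_of_nnnorm_hasDerivWithin_le
    (fun t ht => (hd t ht).hasDerivWithinAt) fun t ht => ?_
  exact_mod_cast hv t ht

/-- Limits of solutions of `ẋ = G k x` solve the limiting equation `ẋ = g x`. -/
theorem exists_subseq_hasDerivAt [ProperSpace E] {g : E → E} (hg : Continuous g) {G : ℕ → E → E}
    {R τ : ℝ} {M : ℝ≥0} (hτ : 0 < τ)
    (hG : TendstoUniformlyOn G g atTop (Metric.closedBall 0 R))
    (hM : ∀ k, ∀ ξ ∈ Metric.closedBall (0 : E) R, ‖G k ξ‖ ≤ M) {x : ℕ → ℝ → E}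
    (hc : ∀ k, ContinuousOn (x k) (Icc 0 τ)) (hR : ∀ k, ∀ t ∈ Icc 0 τ, ‖x k t‖ ≤ R)
    (hd : ∀ k, ∀ t ∈ Ioo 0 τ, HasDerivAt (x k) (G k (x k t)) t) :
    ∃ (φ : ℕ → ℕ) (y : ℝ → E), StrictMono φ ∧ ContinuousOn y (Icc 0 τ) ∧
      (∀ t ∈ Icc 0 τ, Tendsto (fun k => x (φ k) t) atTop (𝓝 (y t))) ∧
      ∀ t ∈ Ioo 0 τ, HasDerivAt y (g (y t)) t := by
  have hmem : ∀ k, ∀ t ∈ Icc 0 τ, x k t ∈ Metric.closedBall (0 : E) R := fun k t ht => by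
    simpa using hR k t ht
  obtain ⟨φ, y, hφ, hy, hlim⟩ := exists_subseq_tendstoUniformlyOn (M := M)
    (fun k => lipschitzOnWith_Icc_of_hasDerivAt hτ (hc k) (hd k)
      fun t ht => hM k _ (hmem k t (Ioo_subset_Icc_self ht))) hR
  have hpt : ∀ t ∈ Icc 0 τ, Tendsto (fun k => x (φ k) t) atTop (𝓝 (y t)) :=
    fun t ht => hlim.tendsto_at ht
  have hymem : ∀ t ∈ Icc 0 τ, y t ∈ Metric.closedBall (0 : E) R := fun t ht =>
    Metric.isClosed_closedBall.mem_of_tendsto (hpt t ht)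
      (Eventually.of_forall fun k => hmem _ t ht)
  refine ⟨φ, y, hφ, hy, hpt, fun t ht => ?_⟩
  refine hasDerivAt_of_tendstoUniformlyOn (f := fun k => x (φ k))
    (f' := fun k t => G (φ k) (x (φ k) t)) (g' := fun t => g (y t)) (l := atTop) isOpen_Ioo ?_
    (Eventually.of_forall fun k t ht => hd (φ k) t ht)
    (fun t ht => hpt t (Ioo_subset_Icc_self ht)) ht
  -- It remains to see that the derivatives converge uniformly: `G k` is uniformly close to `g` on
  -- the ball, and `g` is uniformly continuous there.
  have hgu : UniformContinuousOn g (Metric.closedBall 0 R) :=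
    (isCompact_closedBall 0 R).uniformContinuousOn_of_continuous hg.continuousOn
  rw [Metric.uniformContinuousOn_iff] at hgu
  rw [Metric.tendstoUniformlyOn_iff] at hG hlim ⊢
  intro ε hε
  obtain ⟨δ, hδ, hgδ⟩ := hgu (ε / 2) (half_pos hε)
  filter_upwards [hlim δ hδ, hφ.tendsto_atTop.eventually (hG (ε / 2) (half_pos hε))]
    with k h₁ h₂ t ht
  have ht' := Ioo_subset_Icc_self ht
  calc dist (g (y t)) (G (φ k) (x (φ k) t))
      ≤ dist (g (y t)) (g (x (φ k) t)) + dist (g (x (φ k) t)) (G (φ k) (x (φ k) t)) :=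
        dist_triangle _ _ _
    _ < ε / 2 + ε / 2 := add_lt_add (hgδ _ (hymem t ht') _ (hmem _ t ht') (h₁ t ht'))
        (h₂ _ (hmem _ t ht'))
    _ = ε := add_halves ε

/-- **Peano existence theorem** for autonomous equations. -/
theorem exists_hasDerivAt_of_continuous [FiniteDimensional ℝ E] {g : E → E} (hg : Continuous g)
    (ξ : E) : ∃ (τ : ℝ) (y : ℝ → E), 0 < τ ∧ y 0 = ξ ∧ ContinuousOn y (Icc 0 τ) ∧
      ∀ t ∈ Ioo 0 τ, HasDerivAt y (g (y t)) t := by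
  have : ProperSpace E := FiniteDimensional.proper ℝ E
  obtain ⟨M₀, hM₀⟩ := (isCompact_closedBall (0 : E) (‖ξ‖ + 1)).exists_bound_of_continuousOn
    hg.continuousOn
  set M : ℝ := max M₀ 1
  have hM1 : 1 ≤ M := le_max_right _ _
  have hMg : ∀ η ∈ Metric.closedBall (0 : E) (‖ξ‖ + 1), ‖g η‖ ≤ M := fun η hη =>
    (hM₀ η hη).trans (le_max_left _ _)
  have hpos : ∀ η, 0 < max M ‖g η‖ := fun η => lt_max_of_lt_left (by linarith)
  -- Truncation of `g`: unchanged on the ball of radius `‖ξ‖ + 1`, bounded by `M` everywhere, so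
  -- that its smooth approximations are globally bounded by `M + 1`.
  let h : E → E := fun η => (M / max M ‖g η‖) • g η
  have hh : Continuous h := by
    refine (Continuous.div continuous_const (by fun_prop) fun η => (hpos η).ne').smul hg
  have hhM : ∀ η, ‖h η‖ ≤ M := fun η => by
    rw [norm_smul, Real.norm_of_nonneg (by have := hpos η; positivity), div_mul_eq_mul_div,
      div_le_iff₀ (hpos η)]
    gcongr
    exact le_max_right _ _
  have hhg : ∀ η ∈ Metric.closedBall (0 : E) (‖ξ‖ + 1), h η = g η := fun η hη => by
    simp only [h, max_eq_left (hMg η hη), div_self (by linarith : M ≠ 0), one_smul]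
  have happ : ∀ k : ℕ, ∃ G : E → E, ContDiff ℝ 1 G ∧ ∀ η, dist (G η) (h η) < 1 / ((k : ℝ) + 1) := by
    intro k
    obtain ⟨G, h₁, h₂, -⟩ := hh.exists_contDiff_approx (ε := fun _ => 1 / ((k : ℝ) + 1)) 1
      continuous_const (fun _ => by positivity)
    exact ⟨G, h₁, h₂⟩
  choose G hGc hGh using happ
  have hGM : ∀ k η, ‖G k η‖ ≤ M + 1 := fun k η => by
    have h₁ := hGh k η
    have h₂ : 1 / ((k : ℝ) + 1) ≤ 1 := by
      rw [div_le_one (by positivity)]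
      linarith [(k.cast_nonneg : (0 : ℝ) ≤ k)]
    rw [dist_eq_norm] at h₁
    have h₃ := norm_add_le (G k η - h η) (h η)
    rw [sub_add_cancel] at h₃
    linarith [hhM η]
  -- At speed at most `M + 1` the approximate solutions move by at most `1` up to time `τ`, hence
  -- stay where `h = g`.
  set τ : ℝ := 1 / (M + 1)
  have hτ : 0 < τ := by positivity
  have hMτ : (M + 1) * τ = 1 := by
    simp only [τ]
    field_simp
  have hsol : ∀ k, ∃ x : ℝ → E, x 0 = ξ ∧
      ∀ t ∈ Icc 0 τ, HasDerivWithinAt x (G k (x t)) (Icc 0 τ) t := by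
    intro k
    obtain ⟨K, hK⟩ := (hGc k).contDiffOn.exists_lipschitzOnWith (s := Metric.closedBall ξ 1)
      one_ne_zero (convex_closedBall _ _) (isCompact_closedBall _ _)
    have hpl : IsPicardLindelof (fun _ => G k) (tmin := 0) (tmax := τ) ⟨0, le_rfl, hτ.le⟩ ξ
        1 0 ⟨M + 1, by linarith⟩ K := by
      refine IsPicardLindelof.of_time_independent (fun η _ => hGM k η) hK ?_
      change (M + 1) * max (τ - 0) (0 - 0) ≤ 1 - 0
      rw [sub_zero, sub_zero, max_eq_left hτ.le, hMτ, sub_zero]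
    exact hpl.exists_eq_forall_mem_Icc_hasDerivWithinAt₀
  choose x hx0 hxd using hsol
  have hxR : ∀ k, ∀ t ∈ Icc 0 τ, ‖x k t‖ ≤ ‖ξ‖ + 1 := fun k t ht => by
    have h₁ := (convex_Icc 0 τ).norm_image_sub_le_of_norm_hasDerivWithin_le (hxd k)
      (fun s _ => hGM k (x k s)) (left_mem_Icc.2 hτ.le) ht
    rw [hx0, sub_zero, Real.norm_of_nonneg ht.1] at h₁
    have h₂ : (M + 1) * t ≤ (M + 1) * τ := by
      gcongr
      exact ht.2
    have h₃ := norm_add_le (x k t - ξ) ξ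
    rw [sub_add_cancel] at h₃
    linarith
  have hGu : TendstoUniformlyOn G g atTop (Metric.closedBall 0 (‖ξ‖ + 1)) := by
    rw [Metric.tendstoUniformlyOn_iff]
    intro ε hε
    filter_upwards [(tendsto_order.1 (tendsto_one_div_add_atTop_nhds_zero_nat (𝕜 := ℝ))).2 ε hε]
      with k hk η hη
    rw [← hhg η hη, dist_comm]
    exact (hGh k η).trans hk
  obtain ⟨φ, y, -, hy, hlim, hyd⟩ := exists_subseq_hasDerivAt (M := ⟨M + 1, by linarith⟩) hg hτ hGu
    (fun k η _ => hGM k η) (fun k t ht => (hxd k t ht).continuousWithinAt) hxR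
    (fun k t ht => (hxd k t (Ioo_subset_Icc_self ht)).hasDerivAt (Icc_mem_nhds ht.1 ht.2))
  refine ⟨τ, y, hτ, ?_, hy, hyd⟩
  refine tendsto_nhds_unique (hlim 0 (left_mem_Icc.2 hτ.le)) ?_
  simp only [hx0, tendsto_const_nhds]

end Compactness

/-! ### Switching signals and their switching times -/

section Signals

variable {m : ℕ} {σ : ℝ → Fin m}

theorem IsSwitchingSignal.eventually_notMem_discontinuities (hσ : IsSwitchingSignal σ) (T : ℝ) :
    ∀ᶠ t in 𝓝[≠] T, t ∉ discontinuities σ := by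
  have hfin : ((discontinuities σ ∩ Iic (T + 1)) \ {T}).Finite := (hσ.locally_finite _).sdiff
  have h₁ : ∀ᶠ t in 𝓝 T, t ∉ (discontinuities σ ∩ Iic (T + 1)) \ {T} :=
    hfin.isClosed.isOpen_compl.mem_nhds (by simp)
  filter_upwards [nhdsWithin_le_nhds h₁, nhdsWithin_le_nhds (Iio_mem_nhds (lt_add_one T)),
    self_mem_nhdsWithin] with t ht htT hne hd
  exact ht ⟨⟨hd, mem_Iic.2 (mem_Iio.1 htT).le⟩, hne⟩

/-- A continuous map from a connected set to a discrete space is constant; at `a` itself right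
continuity suffices, so `a` may be a switching time. -/
theorem IsSwitchingSignal.eq_of_forall_notMem_discontinuities (hσ : IsSwitchingSignal σ) {a b : ℝ}
    (ha : 0 ≤ a) (h : ∀ t ∈ Ioo a b, t ∉ discontinuities σ) {t : ℝ} (ht : t ∈ Ico a b) :
    σ t = σ a := by
  refine isPreconnected_Icc.constant (s := Icc a t) (f := σ) ?_ (right_mem_Icc.2 ht.1)
    (left_mem_Icc.2 ht.1)
  intro u hu
  rcases hu.1.eq_or_lt with rfl | hau
  · exact (hσ.right_continuous _ ha).mono Icc_subset_Ici_self
  · have h₁ := h u ⟨hau, hu.2.trans_lt ht.2⟩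
    simp only [discontinuities, mem_ofPred_eq, not_and, not_not] at h₁
    exact (h₁ (ha.trans_lt hau)).continuousWithinAt

theorem IsSwitchingSignal.eq_of_forall_notMem_discontinuities_Icc (hσ : IsSwitchingSignal σ)
    {a b : ℝ} (ha : 0 ≤ a) (h : ∀ t ∈ Ioc a b, t ∉ discontinuities σ) {t : ℝ} (ht : t ∈ Icc a b) :
    σ t = σ a := by
  rcases ht.1.eq_or_lt with rfl | hat
  · rfl
  have hcont : ContinuousAt σ t := by
    have h₁ := h t ⟨hat, ht.2⟩
    simp only [discontinuities, mem_ofPred_eq, not_and, not_not] at h₁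
    exact h₁ (ha.trans_lt hat)
  have h₁ : ∀ᶠ u in 𝓝[<] t, σ u = σ t := by
    refine nhdsWithin_le_nhds
      (hcont.eventually_mem ((isOpen_discrete {σ t}).mem_nhds (mem_singleton _)))
  have h₂ : ∀ᶠ u in 𝓝[<] t, u ∈ Ico a t := Ico_mem_nhdsLT hat
  obtain ⟨u, hu₁, hu₂⟩ := (h₁.and h₂).exists
  rw [← hu₁]
  exact hσ.eq_of_forall_notMem_discontinuities ha
    (fun s hs => h s ⟨hs.1, hs.2.le.trans ht.2⟩) hu₂

theorem notMem_switchingTimes {t : ℝ} (h₀ : t ≠ 0) (h : t ∉ discontinuities σ) :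
    t ∉ switchingTimes σ := by
  simp [switchingTimes, h₀, h]

theorem nonneg_of_mem_switchingTimes {t : ℝ} (h : t ∈ switchingTimes σ) : 0 ≤ t := by
  rcases h with rfl | h
  · exact le_rfl
  · exact h.1.le

theorem IsSwitchingSignal.finite_switchingTimes_inter_Iic (hσ : IsSwitchingSignal σ) (T : ℝ) :
    (switchingTimes σ ∩ Iic T).Finite := by
  rw [switchingTimes, insert_eq, union_inter_distrib_right]
  exact ((finite_singleton 0).inter_of_left _).union (hσ.locally_finite T)

/-- Every time `t ≥ 0` is preceded by a last switching time. -/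
theorem IsSwitchingSignal.exists_isGreatest (hσ : IsSwitchingSignal σ) {t : ℝ} (ht : 0 ≤ t) :
    ∃ s, IsGreatest (switchingTimes σ ∩ Iic t) s := by
  obtain ⟨s, hs, hmax⟩ := (hσ.finite_switchingTimes_inter_Iic t).exists_maximalFor id _
    ⟨0, mem_insert _ _, ht⟩
  exact ⟨s, hs, fun r hr => le_of_not_gt fun h => h.not_ge (hmax hr h.le)⟩

/-- A switching time that is followed by another one has an immediate successor. -/
theorem IsSwitchingSignal.exists_isLeast (hσ : IsSwitchingSignal σ) {s r : ℝ}
    (hr : r ∈ switchingTimes σ) (hsr : s < r) :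
    ∃ s', IsLeast {r | r ∈ switchingTimes σ ∧ s < r} s' := by
  have hfin : ({r | r ∈ switchingTimes σ ∧ s < r} ∩ Iic r).Finite :=
    (hσ.finite_switchingTimes_inter_Iic r).subset fun u hu => ⟨hu.1.1, hu.2⟩
  obtain ⟨s', hs', hmin⟩ := hfin.exists_minimalFor id _ ⟨r, ⟨hr, hsr⟩, mem_Iic.2 le_rfl⟩
  refine ⟨s', hs'.1, fun u hu => ?_⟩
  by_contra! h
  exact h.not_ge (hmin ⟨hu, h.le.trans hs'.2⟩ h.le)

end Signals

/-! ### Continuation of bounded solutions -/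

section Continuation

variable {n m : ℕ} {f : Fin m → EuclideanSpace ℝ (Fin n) → EuclideanSpace ℝ (Fin n)}
  {σ : ℝ → Fin m} {x : ℝ → EuclideanSpace ℝ (Fin n)}

/-- A bounded solution on `[0, T)` extends to `[0, T]`. -/
theorem IsSolution.exists_extension_Icc (hf : ∀ γ, Continuous (f γ)) (hσ : IsSwitchingSignal σ)
    {T R : ℝ} (hT : 0 < T) (hx : IsSolution f σ x (Ico 0 T)) (hR : ∀ t ∈ Ico 0 T, ‖x t‖ ≤ R) :
    ∃ y, IsSolution f σ y (Icc 0 T) ∧ EqOn x y (Ico 0 T) := by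
  have hev : ∀ᶠ t in 𝓝[<] T, t ∉ discontinuities σ :=
    (hσ.eventually_notMem_discontinuities T).filter_mono (nhdsWithin_mono _ fun t ht => ne_of_lt ht)
  obtain ⟨b, hbT, hb⟩ := (mem_nhdsLT_iff_exists_Ioo_subset' hT).1 hev
  obtain ⟨a, haa, haT⟩ := exists_between (max_lt hT hbT)
  have ha0 : 0 < a := (le_max_left _ _).trans_lt haa
  have hba : b < a := (le_max_right _ _).trans_lt haa
  have hd : ∀ t ∈ Ioo a T, HasDerivAt x (f (σ a) (x t)) t := fun t ht => by
    have h₁ := hx.ode t ⟨(ha0.trans ht.1).le, ht.2⟩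
      (notMem_switchingTimes (ha0.trans ht.1).ne' (hb ⟨hba.trans ht.1, ht.2⟩))
    rw [hσ.eq_of_forall_notMem_discontinuities ha0.le
      (fun s hs => hb ⟨hba.trans hs.1, hs.2⟩) ⟨ht.1.le, ht.2⟩] at h₁
    exact h₁.hasDerivAt (Ico_mem_nhds (ha0.trans ht.1) ht.2)
  obtain ⟨M, hM⟩ := (isCompact_closedBall (0 : EuclideanSpace ℝ (Fin n))
    R).exists_bound_of_continuousOn (hf (σ a)).continuousOn
  have hLip : LipschitzOnWith M.toNNReal x (Ioo a T) := by
    refine (convex_Ioo a T).lipschitzOnWith_of_nnnorm_hasDerivWithin_le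
      (fun t ht => (hd t ht).hasDerivWithinAt) fun t ht => ?_
    rw [← norm_toNNReal]
    refine Real.toNNReal_le_toNNReal (hM _ ?_)
    exact mem_closedBall_zero_iff.2 (hR t ⟨(ha0.trans ht.1).le, ht.2⟩)
  -- The extension `g` only serves to provide the left limit `g T` of `x` at `T`.
  obtain ⟨g, hg, hxg⟩ := hLip.extend_finite_dimension
  have hIoo : Ioo a T ∈ 𝓝[<] T := Ioo_mem_nhdsLT haT
  have hlim : Tendsto x (𝓝[<] T) (𝓝 (g T)) := by
    refine ((hg.continuous.tendsto T).mono_left nhdsWithin_le_nhds).congr' ?_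
    filter_upwards [hIoo] with t ht using (hxg ht).symm
  have hyne : ∀ t, t ≠ T → Function.update x T (g T) =ᶠ[𝓝 t] x := fun t ht => by
    filter_upwards [isOpen_ne.mem_nhds ht] with s hs using Function.update_of_ne hs _ _
  have hnhds : ∀ t < T, 𝓝[Icc 0 T] t = 𝓝[Ico 0 T] t := fun t ht => by
    refine nhdsWithin_eq_nhdsWithin (s := Iio T) ht isOpen_Iio ?_
    ext s
    simp only [mem_inter_iff, mem_Icc, mem_Ico, mem_Iio]
    constructor
    · rintro ⟨h₁, h₂⟩
      exact ⟨⟨h₁.1, h₂⟩, h₂⟩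
    · rintro ⟨h₁, h₂⟩
      exact ⟨⟨h₁.1, h₂.le⟩, h₂⟩
  have hcT : ContinuousWithinAt (Function.update x T (g T)) (Iic T) T := by
    rw [continuousWithinAt_update_same, Iic_sdiff_right]
    exact hlim
  refine ⟨Function.update x T (g T), ⟨Or.inr ⟨T, hT, Or.inr rfl⟩, fun t ht => ?_, ?_⟩,
    fun t ht => (Function.update_of_ne ht.2.ne _ _).symm⟩
  · rcases ht.2.lt_or_eq with htT | rfl
    · rw [ContinuousWithinAt, hnhds t htT, Function.update_of_ne htT.ne]
      exact (hx.continuousOn t ⟨ht.1, htT⟩).congr' (nhdsWithin_le_nhds (hyne t htT.ne).symm)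
    · exact hcT.mono Icc_subset_Iic_self
  · intro t ht hts
    rcases ht.2.lt_or_eq with htT | rfl
    · have h₁ := hx.ode t ⟨ht.1, htT⟩ hts
      rw [Function.update_of_ne htT.ne]
      refine HasDerivWithinAt.congr_of_eventuallyEq ?_ (nhdsWithin_le_nhds (hyne t htT.ne))
        (Function.update_of_ne htT.ne _ _)
      exact h₁.mono_of_mem_nhdsWithin (hnhds t htT ▸ self_mem_nhdsWithin)
    -- The equation at the end point is required only if this is not a switching time; then the
    -- signal keeps its value up to it, and the derivative there is the limit of the derivatives.
    · have hσT : σ t = σ a := by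
        refine hσ.eq_of_forall_notMem_discontinuities_Icc (b := t) ha0.le (fun s hs => ?_)
          ⟨haT.le, le_rfl⟩
        rcases hs.2.lt_or_eq with h | rfl
        · exact hb ⟨hba.trans hs.1, h⟩
        · exact fun h => hts (mem_insert_of_mem _ h)
      have hderiv : ∀ s ∈ Ioo a t, HasDerivAt (Function.update x t (g t)) (f (σ a) (x s)) s :=
        fun s hs => (hd s hs).congr_of_eventuallyEq (hyne s hs.2.ne)
      refine HasDerivWithinAt.mono ?_ (Icc_subset_Iic_self (a := 0))
      refine hasDerivWithinAt_Iic_of_tendsto_deriv (s := Ioo a t)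
        (fun s hs => (hderiv s hs).differentiableAt.differentiableWithinAt)
        (hcT.mono fun s hs => hs.2.le) hIoo ?_
      rw [hσT, Function.update_self]
      refine (((hf (σ a)).tendsto _).comp hlim).congr' ?_
      filter_upwards [hIoo] with s hs using (hderiv s hs).deriv.symm

/-- A solution on `[0, T]` can be continued beyond `T`. -/
theorem IsSolution.exists_extension_Ico (hf : ∀ γ, Continuous (f γ)) (hσ : IsSwitchingSignal σ)
    {T : ℝ} (hT : 0 < T) (hx : IsSolution f σ x (Icc 0 T)) :
    ∃ y T', T < T' ∧ IsSolution f σ y (Ico 0 T') ∧ EqOn x y (Icc 0 T) := by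
  have hev : ∀ᶠ t in 𝓝[>] T, t ∉ discontinuities σ :=
    (hσ.eventually_notMem_discontinuities T).filter_mono
      (nhdsWithin_mono _ fun t ht => ne_of_gt ht)
  obtain ⟨b, hTb, hb⟩ := (mem_nhdsGT_iff_exists_Ioo_subset' (lt_add_one T)).1 hev
  obtain ⟨ε, z, hε, hz0, hzc, hzd⟩ := exists_hasDerivAt_of_continuous (hf (σ T)) (x T)
  set T' := min b (T + ε)
  have hTT' : T < T' := lt_min hTb (lt_add_of_pos_right T hε)
  have hT'b : T' ≤ b := min_le_left _ _
  have hT'ε : T' ≤ T + ε := min_le_right _ _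
  let y : ℝ → EuclideanSpace ℝ (Fin n) := fun t => if t ≤ T then x t else z (t - T)
  have hyx : ∀ t ≤ T, y t = x t := fun t ht => if_pos ht
  have hyz : ∀ t, T ≤ t → y t = z (t - T) := fun t ht => by
    rcases ht.eq_or_lt with rfl | h
    · rw [hyx _ le_rfl, sub_self, hz0]
    · exact if_neg h.not_ge
  have hcr : ContinuousOn y (Ico T T') := by
    refine ContinuousOn.congr (f := fun t => z (t - T)) ?_ fun t ht => hyz t ht.1
    refine hzc.comp (by fun_prop) fun t ht => ?_
    constructor <;> linarith [ht.1, ht.2]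
  have hcl : ContinuousOn y (Icc 0 T) := hx.continuousOn.congr fun t ht => hyx t ht.2
  have hdr : ∀ t ∈ Ioo T T', HasDerivAt y (f (σ T) (y t)) t := fun t ht => by
    rw [hyz t ht.1.le]
    refine HasDerivAt.congr_of_eventuallyEq (f := fun t => z (t - T)) ?_ ?_
    · exact (hzd (t - T) ⟨by linarith [ht.1], by linarith [ht.2]⟩).comp_sub_const t T
    · filter_upwards [Ioi_mem_nhds ht.1] with s hs using hyz s (mem_Ioi.1 hs).le
  have hσr : ∀ t ∈ Ico T T', σ t = σ T := fun t ht =>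
    hσ.eq_of_forall_notMem_discontinuities hT.le
      (fun s hs => hb ⟨hs.1, hs.2.trans_le hT'b⟩) ht
  have hsub : Ico 0 T' ⊆ Icc 0 T ∪ Ici T := fun t ht =>
    (le_total t T).imp (fun h => ⟨ht.1, h⟩) id
  refine ⟨y, T', hTT', ⟨Or.inr ⟨T', hT.trans hTT', Or.inl rfl⟩, ?_, ?_⟩,
    fun t ht => (hyx t ht.2).symm⟩
  · intro t ht
    rcases lt_trichotomy t T with h | rfl | h
    · refine (hcl t ⟨ht.1, h.le⟩).mono_of_mem_nhdsWithin ?_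
      filter_upwards [self_mem_nhdsWithin, nhdsWithin_le_nhds (Iio_mem_nhds h)] with s hs hs'
      exact ⟨hs.1, (mem_Iio.1 hs').le⟩
    · refine ((hcl t ⟨ht.1, le_rfl⟩).union (hcr t ⟨le_rfl, ht.2⟩)).mono fun s hs => ?_
      exact (le_total s t).imp (fun h => ⟨hs.1, h⟩) fun h => ⟨h, hs.2⟩
    · exact (hdr t ⟨h, ht.2⟩).continuousAt.continuousWithinAt
  · intro t ht hts
    rcases lt_trichotomy t T with h | rfl | h
    · have h₁ := hx.ode t ⟨ht.1, h.le⟩ hts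
      rw [← hyx t h.le] at h₁
      refine (h₁.congr_of_mem (fun s hs => hyx s hs.2) ⟨ht.1, h.le⟩).mono_of_mem_nhdsWithin ?_
      filter_upwards [self_mem_nhdsWithin, nhdsWithin_le_nhds (Iio_mem_nhds h)] with s hs hs'
      exact ⟨hs.1, (mem_Iio.1 hs').le⟩
    · have h₁ := hx.ode t ⟨ht.1, le_rfl⟩ hts
      rw [← hyx t le_rfl] at h₁
      -- At the junction, if it is not a switching time, the old solution gives the left derivative
      -- and the limit of the derivatives of the Peano solution gives the same right derivative.
      refine ((h₁.congr_of_mem (fun s hs => hyx s hs.2) ⟨ht.1, le_rfl⟩).union ?_).mono hsub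
      refine hasDerivWithinAt_Ici_of_tendsto_deriv (s := Ioo t T')
        (fun s hs => (hdr s hs).differentiableAt.differentiableWithinAt)
        ((hcr t ⟨le_rfl, hTT'⟩).mono Ioo_subset_Ico_self) (Ioo_mem_nhdsGT hTT') ?_
      have h₂ : Tendsto y (𝓝[>] t) (𝓝 (y t)) :=
        (hcr t ⟨le_rfl, hTT'⟩).mono_left
          (nhdsWithin_le_of_mem (mem_of_superset (Ioo_mem_nhdsGT hTT') Ioo_subset_Ico_self))
      refine (((hf (σ t)).tendsto _).comp h₂).congr' ?_
      filter_upwards [Ioo_mem_nhdsGT hTT'] with s hs using (hdr s hs).deriv.symm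
    · have h₁ := (hdr t ⟨h, ht.2⟩).hasDerivWithinAt (s := Ico 0 T')
      rwa [← hσr t ⟨h.le, ht.2⟩] at h₁

/-- A bounded maximal solution is defined for all times. -/
theorem IsMaximalSolution.eq_Ici_of_bounded (hf : ∀ γ, Continuous (f γ))
    (hσ : IsSwitchingSignal σ) {I : Set ℝ} {R : ℝ} (hx : IsMaximalSolution f σ x I)
    (hR : ∀ t ∈ I, ‖x t‖ ≤ R) : I = Ici 0 := by
  rcases hx.1.interval with h | ⟨T, hT, rfl | rfl⟩
  · exact h
  · obtain ⟨y, hy, hxy⟩ := hx.1.exists_extension_Icc hf hσ hT hR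
    have h := hx.2 y _ hy Ico_subset_Icc_self hxy
    have hmem : T ∈ Ico 0 T := h ▸ right_mem_Icc.2 hT.le
    exact absurd hmem.2 (lt_irrefl T)
  · obtain ⟨y, T', hTT', hy, hxy⟩ := hx.1.exists_extension_Ico hf hσ hT
    have h := hx.2 y _ hy (fun t ht => ⟨ht.1, ht.2.trans_lt hTT'⟩) hxy
    obtain ⟨s, hs₁, hs₂⟩ := exists_between hTT'
    have hmem : s ∈ Icc 0 T := h ▸ ⟨(hT.trans hs₁).le, hs₂⟩
    exact absurd hmem.2 hs₁.not_ge

end Continuation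

/-! ### Comparison functions -/

section ComparisonFunctions

theorem isClassKInfty_id : IsClassKInfty fun r => r :=
  ⟨strictMono_id, continuous_id, rfl, fun M => ⟨M + 1, lt_add_one M⟩⟩

theorem IsClassKInfty.exists_le {α : ℝ≥0 → ℝ≥0} (h : IsClassKInfty α) (M : ℝ≥0) :
    ∃ s, M ≤ α s :=
  (h.unbounded M).imp fun _ => le_of_lt

theorem IsClassKInfty.comp {α β : ℝ≥0 → ℝ≥0} (hα : IsClassKInfty α) (hβ : IsClassKInfty β) :
    IsClassKInfty (α ∘ β) := by
  refine ⟨hα.strictMono.comp hβ.strictMono, hα.continuous.comp hβ.continuous, ?_, fun M => ?_⟩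
  · simp [hα.map_zero, hβ.map_zero]
  · obtain ⟨s, hs⟩ := hα.unbounded M
    obtain ⟨r, hr⟩ := hβ.unbounded s
    exact ⟨r, hs.trans (hα.strictMono hr)⟩

theorem IsClassKInfty.iterate {α : ℝ≥0 → ℝ≥0} (hα : IsClassKInfty α) (k : ℕ) :
    IsClassKInfty α^[k] := by
  induction k with
  | zero => exact isClassKInfty_id
  | succ k ih => exact ih.comp hα

theorem IsClassKInfty.surjective {α : ℝ≥0 → ℝ≥0} (hα : IsClassKInfty α) :
    Function.Surjective α := by
  intro r
  obtain ⟨s, hs⟩ := hα.exists_le r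
  obtain ⟨u, -, hu⟩ := intermediate_value_Icc (zero_le : 0 ≤ s) hα.continuous.continuousOn
    ⟨by simp [hα.map_zero], hs⟩
  exact ⟨u, hu⟩

theorem IsClassKInfty.exists_rightInverse {α : ℝ≥0 → ℝ≥0} (hα : IsClassKInfty α) :
    ∃ β, IsClassKInfty β ∧ ∀ r, α (β r) = r := by
  let e := StrictMono.orderIsoOfSurjective α hα.strictMono hα.surjective
  have he : ∀ r, α (e.symm r) = r := fun r => e.apply_symm_apply r
  refine ⟨e.symm, ⟨e.symm.strictMono, e.symm.continuous, ?_, fun M => ⟨α (M + 1), ?_⟩⟩, he⟩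
  · exact hα.strictMono.injective ((he 0).trans hα.map_zero.symm)
  · rw [show e.symm (α (M + 1)) = M + 1 from e.symm_apply_apply (M + 1)]
    exact lt_add_one M

theorem IsClassKInfty.add_monotone {α β : ℝ≥0 → ℝ≥0} (hα : IsClassKInfty α) (hβ : Monotone β)
    (hc : Continuous β) (h0 : β 0 = 0) : IsClassKInfty fun r => α r + β r := by
  refine ⟨hα.strictMono.add_monotone hβ, hα.continuous.add hc, by simp [hα.map_zero, h0],
    fun M => ?_⟩
  obtain ⟨s, hs⟩ := hα.unbounded M
  exact ⟨s, hs.trans_le le_self_add⟩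

end ComparisonFunctions

/-! ### Uniform stability -/

section Lyapunov

variable {n m : ℕ} {f : Fin m → EuclideanSpace ℝ (Fin n) → EuclideanSpace ℝ (Fin n)}

theorem IsTimeInterval.nonneg {I : Set ℝ} (hI : IsTimeInterval I) {t : ℝ} (ht : t ∈ I) :
    0 ≤ t := by
  rcases hI with rfl | ⟨T, -, rfl | rfl⟩
  · exact ht
  · exact ht.1
  · exact ht.1

theorem IsTimeInterval.mem_of_le {I : Set ℝ} (hI : IsTimeInterval I) {s t : ℝ} (ht : t ∈ I)
    (hs : 0 ≤ s) (hst : s ≤ t) : s ∈ I := by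
  rcases hI with rfl | ⟨T, -, rfl | rfl⟩
  · exact hs
  · exact ⟨hs, hst.trans_lt ht.2⟩
  · exact ⟨hs, hst.trans ht.2⟩

namespace Trajectory

theorem continuousOn_Icc (p : Trajectory f) {a b : ℝ} (ha : 0 ≤ a) (hb : b ∈ p.dom) :
    ContinuousOn p.state (Icc a b) :=
  p.isSolution.continuousOn.mono fun _ ht =>
    p.isSolution.interval.mem_of_le hb (ha.trans ht.1) ht.2

theorem hasDerivAt (p : Trajectory f) {a b : ℝ} (ha : 0 ≤ a) (hb : b ∈ p.dom)
    (hab : ∀ t ∈ Ioo a b, t ∉ discontinuities p.signal) {t : ℝ} (ht : t ∈ Ioo a b) :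
    HasDerivAt p.state (f (p.signal a) (p.state t)) t := by
  have hmem : ∀ s ∈ Ioo a b, s ∈ p.dom := fun s hs =>
    p.isSolution.interval.mem_of_le hb (ha.trans hs.1.le) hs.2.le
  have h := p.isSolution.ode t (hmem t ht)
    (notMem_switchingTimes (ha.trans_lt ht.1).ne' (hab t ht))
  rw [p.isSwitchingSignal.eq_of_forall_notMem_discontinuities ha hab ⟨ht.1.le, ht.2⟩] at h
  exact h.hasDerivAt (mem_of_superset (Ioo_mem_nhds ht.1 ht.2) hmem)

variable {χ : Fin m → Set (EuclideanSpace ℝ (Fin n))}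

/-- The end point `b` may be a switching time, where the signal has left the mode; membership passes
to it in the limit because `χ γ` is closed. -/
theorem state_mem (p : Trajectory f) (hχ : ∀ γ, IsClosed (χ γ))
    (hp : ∀ t ∈ p.dom, p.state t ∈ χ (p.signal t)) {a b : ℝ} (ha : 0 ≤ a) (hb : b ∈ p.dom)
    (hab : ∀ t ∈ Ioo a b, t ∉ discontinuities p.signal) {t : ℝ} (ht : t ∈ Icc a b) :
    p.state t ∈ χ (p.signal a) := by
  have hmem : ∀ s ∈ Icc a b, s ∈ p.dom := fun s hs =>
    p.isSolution.interval.mem_of_le hb (ha.trans hs.1) hs.2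
  rcases ht.1.eq_or_lt with rfl | hat
  · exact hp a (hmem a ht)
  have hlt : ∀ s ∈ Ico a t, p.state s ∈ χ (p.signal a) := fun s hs => by
    have h := hp s (hmem s ⟨hs.1, hs.2.le.trans ht.2⟩)
    rwa [p.isSwitchingSignal.eq_of_forall_notMem_discontinuities ha hab
      ⟨hs.1, hs.2.trans_le ht.2⟩] at h
  refine (hχ _).mem_of_tendsto (b := 𝓝[<] t) (f := p.state) ?_
    (mem_of_superset (Ico_mem_nhdsLT hat) hlt)
  refine (p.continuousOn_Icc ha hb t ht).mono_left (nhdsWithin_le_of_mem ?_)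
  exact mem_of_superset (Ico_mem_nhdsLT hat) fun s hs => ⟨hs.1, hs.2.le.trans ht.2⟩

end Trajectory

theorem antitoneOn_comp_of_hasDerivAt {E : Type*} [NormedAddCommGroup E] [NormedSpace ℝ E]
    {v : E → ℝ} (hv : ContDiff ℝ 1 v) {x : ℝ → E} {g : E → E} {a b : ℝ}
    (hx : ContinuousOn x (Icc a b)) (hd : ∀ t ∈ Ioo a b, HasDerivAt x (g (x t)) t)
    (h : ∀ t ∈ Ioo a b, fderiv ℝ v (x t) (g (x t)) ≤ 0) :
    AntitoneOn (fun t => v (x t)) (Icc a b) := by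
  have hd' : ∀ t ∈ Ioo a b, HasDerivAt (fun t => v (x t)) (fderiv ℝ v (x t) (g (x t))) t :=
    fun t ht => ((hv.differentiable one_ne_zero) (x t)).hasFDerivAt.comp_hasDerivAt t (hd t ht)
  refine antitoneOn_of_deriv_nonpos (convex_Icc a b) (hv.continuous.comp_continuousOn hx) ?_ ?_
  · rw [interior_Icc]
    exact fun t ht => (hd' t ht).differentiableAt.differentiableWithinAt
  · rw [interior_Icc]
    exact fun t ht => (hd' t ht).deriv.trans_le (h t ht)

namespace IsWeakLyapunovLike

variable {χ : Fin m → Set (EuclideanSpace ℝ (Fin n))} {T' : Set (Trajectory f)}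
  {V : EuclideanSpace ℝ (Fin n) → Fin m → ℝ}

theorem mono (hV : IsWeakLyapunovLike χ T' V) {S : Set (Trajectory f)} (hS : S ⊆ T') :
    IsWeakLyapunovLike χ S V :=
  ⟨hV.contDiff, hV.bounds, hV.decreasing, fun p hp => hV.switching p (hS hp)⟩

theorem nonneg (hV : IsWeakLyapunovLike χ T' V) {γ : Fin m} {ξ : EuclideanSpace ℝ (Fin n)}
    (hξ : ξ ∈ χ γ) : 0 ≤ V ξ γ := by
  obtain ⟨α₁, α₂, -, -, h⟩ := hV.bounds
  exact (α₁ _).coe_nonneg.trans (h γ ξ hξ).1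

variable (hχ : ∀ γ, IsClosed (χ γ)) (hV : IsWeakLyapunovLike χ T' V)
include hχ hV

/-- Between consecutive switching times the active Lyapunov function does not increase. -/
theorem antitoneOn {p : Trajectory f} (hp : ∀ t ∈ p.dom, p.state t ∈ χ (p.signal t)) {a b : ℝ}
    (ha : 0 ≤ a) (hb : b ∈ p.dom) (hab : ∀ t ∈ Ioo a b, t ∉ discontinuities p.signal) :
    AntitoneOn (fun t => V (p.state t) (p.signal a)) (Icc a b) :=
  antitoneOn_comp_of_hasDerivAt (hV.contDiff _) (p.continuousOn_Icc ha hb)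
    (fun _ ht => p.hasDerivAt ha hb hab ht)
    fun _ ht => hV.decreasing _ _ (p.state_mem hχ hp ha hb hab (Ioo_subset_Icc_self ht))

/-- If the mode active on `[a, a')` is active again at time `b ≥ a'`, its Lyapunov function has not
increased in between. -/
theorem le_of_signal_eq {p : Trajectory f} (hpT : p ∈ T')
    (hp : ∀ t ∈ p.dom, p.state t ∈ χ (p.signal t)) {a a' b : ℝ} (ha : 0 ≤ a) (haa' : a ≤ a')
    (ha'b : a' ≤ b) (hb : b ∈ p.dom) (haa : ∀ t ∈ Ioo a a', t ∉ discontinuities p.signal)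
    (hσ : p.signal b = p.signal a) :
    V (p.state b) (p.signal a) ≤ V (p.state a') (p.signal a) := by
  by_cases hab : ∀ t ∈ Ioc a b, t ∉ discontinuities p.signal
  · exact hV.antitoneOn hχ hp ha hb (fun t ht => hab t ⟨ht.1, ht.2.le⟩) ⟨haa', ha'b⟩
      ⟨haa'.trans ha'b, le_rfl⟩ ha'b
  push Not at hab
  obtain ⟨r, hr, hrd⟩ := hab
  have hdom : ∀ t, 0 ≤ t → t ≤ b → t ∈ p.dom := fun t h₁ h₂ =>
    p.isSolution.interval.mem_of_le hb h₁ h₂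
  -- The switching condition speaks of switching times only, so `a` and `b` are replaced by the last
  -- switching times `s ≤ a` and `t ≤ b`. With `s'` the successor of `s`, the values of the common
  -- Lyapunov function at `b`, `t`, `s'`, `a'` form an increasing chain.
  obtain ⟨s, hs, hsmax⟩ := p.isSwitchingSignal.exists_isGreatest ha
  have hsa : s ≤ a := hs.2
  have hs0 : 0 ≤ s := nonneg_of_mem_switchingTimes hs.1
  have hsσ : p.signal a = p.signal s :=
    p.isSwitchingSignal.eq_of_forall_notMem_discontinuities_Icc hs0
      (fun u hu hud => (hsmax ⟨mem_insert_of_mem _ hud, hu.2⟩).not_gt hu.1) ⟨hsa, le_rfl⟩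
  obtain ⟨s', hs', hs'min⟩ := p.isSwitchingSignal.exists_isLeast (mem_insert_of_mem 0 hrd)
    (hsa.trans_lt hr.1)
  have has' : a < s' := by
    by_contra! h
    exact (hsmax ⟨hs'.1, h⟩).not_gt hs'.2
  have hs'b : s' ≤ b := (hs'min ⟨mem_insert_of_mem _ hrd, hsa.trans_lt hr.1⟩).trans hr.2
  have ha's' : a' ≤ s' := by
    by_contra! h
    rcases hs'.1 with h₀ | hd
    · linarith
    · exact haa s' ⟨has', h⟩ hd
  obtain ⟨t, ht, htmax⟩ := p.isSwitchingSignal.exists_isGreatest (ha.trans (haa'.trans ha'b))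
  have htb : t ≤ b := ht.2
  have ht0 : 0 ≤ t := nonneg_of_mem_switchingTimes ht.1
  have hnd : ∀ u ∈ Ioc t b, u ∉ discontinuities p.signal := fun u hu hud =>
    (htmax ⟨mem_insert_of_mem _ hud, hu.2⟩).not_gt hu.1
  have htσ : p.signal b = p.signal t :=
    p.isSwitchingSignal.eq_of_forall_notMem_discontinuities_Icc ht0 hnd ⟨htb, le_rfl⟩
  have hs't : s' ≤ t := htmax ⟨hs'.1, hs'b⟩
  have h₁ := hV.antitoneOn hχ hp ht0 hb (fun u hu => hnd u ⟨hu.1, hu.2.le⟩)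
    (left_mem_Icc.2 htb) (right_mem_Icc.2 htb) htb
  have h₂ := hV.switching p hpT s s' t hs.1 ht.1 (hdom t ht0 htb) (hs'.2.trans_le hs't)
    ⟨hs', hs'min⟩ (by rw [← hsσ, ← hσ, htσ])
  have h₃ := hV.antitoneOn hχ hp ha (hdom s' (ha.trans has'.le) hs'b) (fun u hu hud =>
    (hs'min ⟨mem_insert_of_mem _ hud, hsa.trans_lt hu.1⟩).not_gt hu.2) ⟨haa', ha's'⟩
    (right_mem_Icc.2 has'.le) ha's'
  simp only at h₁ h₃
  rw [← htσ, hσ] at h₁ h₂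
  rw [← hsσ] at h₂
  exact h₁.trans (h₂.trans h₃)

/-- The norm grows at most by one application of `α` for every mode that is active. -/
theorem nnnorm_state_le_iterate {α α₁ α₂ : ℝ≥0 → ℝ≥0} (hα₁ : IsClassKInfty α₁)
    (hbd : ∀ γ, ∀ ξ ∈ χ γ, (α₁ ‖ξ‖₊ : ℝ) ≤ V ξ γ ∧ V ξ γ ≤ α₂ ‖ξ‖₊) (hα : Monotone α)
    (hid : ∀ r, r ≤ α r) (hαα : ∀ r, α₂ r ≤ α₁ (α r)) {p : Trajectory f} (hpT : p ∈ T')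
    (hp : ∀ t ∈ p.dom, p.state t ∈ χ (p.signal t)) (k : ℕ) :
    ∀ (S : Finset (Fin m)), S.card = k → ∀ {t₀ t : ℝ}, 0 ≤ t₀ → t₀ ≤ t → t ∈ p.dom →
      (∀ u ∈ Icc t₀ t, p.signal u ∈ S) → ‖p.state t‖₊ ≤ α^[k] ‖p.state t₀‖₊ := by
  induction k with
  | zero =>
    intro S hS t₀ t _ h _ hu
    rw [Finset.card_eq_zero] at hS
    simpa [hS] using hu t ⟨h, le_rfl⟩
  | succ k ih =>
    intro S hS t₀ t ht₀ htt htd hu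
    have hdom : ∀ s, 0 ≤ s → s ≤ t → s ∈ p.dom := fun s h₁ h₂ =>
      p.isSolution.interval.mem_of_le htd h₁ h₂
    set A : Set ℝ := {s | s ∈ Icc t₀ t ∧ p.signal s = p.signal t}
    have hAne : A.Nonempty := ⟨t, ⟨htt, le_rfl⟩, rfl⟩
    have hAbdd : BddBelow A := ⟨t₀, fun s hs => hs.1.1⟩
    set r := sInf A
    have ht₀r : t₀ ≤ r := le_csInf hAne fun s hs => hs.1.1
    have hrt : r ≤ t := csInf_le hAbdd ⟨⟨htt, le_rfl⟩, rfl⟩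
    have hr0 : 0 ≤ r := ht₀.trans ht₀r
    -- Right continuity makes the infimum a minimum: the mode of time `t` is already active at `r`.
    have hσr : p.signal t = p.signal r := by
      have h₁ := (p.isSwitchingSignal.right_continuous r hr0).eventually_mem
        ((isOpen_discrete {p.signal r}).mem_nhds (mem_singleton _))
      obtain ⟨b, hrb, hb⟩ := mem_nhdsGE_iff_exists_Ico_subset.1 h₁
      obtain ⟨s, hsA, hsb⟩ := exists_lt_of_csInf_lt hAne (mem_Ioi.1 hrb)
      exact hsA.2.symm.trans (hb ⟨csInf_le hAbdd hsA, hsb⟩)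
    have h₁ : ‖p.state t‖₊ ≤ α ‖p.state r‖₊ := by
      have h := hV.le_of_signal_eq hχ hpT hp hr0 le_rfl hrt htd
        (fun s hs => absurd hs.1 hs.2.not_gt) hσr
      have h₂ := (hbd _ _ (hp t htd)).1
      have h₃ := (hbd _ _ (hp r (hdom r hr0 hrt))).2
      rw [hσr] at h₂
      refine hα₁.strictMono.le_iff_le.1 (le_trans ?_ (hαα _))
      exact_mod_cast h₂.trans (h.trans h₃)
    rw [Function.iterate_succ_apply']
    refine h₁.trans (hα ?_)
    rcases ht₀r.eq_or_lt with h | h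
    · rw [← h]
      exact Function.id_le_iterate_of_id_le hid k _
    -- On `[t₀, r)` the mode of time `t` never occurs, so one mode fewer is in use; the estimate
    -- reaches `r` by continuity of the state.
    have h₂ : ∀ u ∈ Ico t₀ r, ‖p.state u‖₊ ≤ α^[k] ‖p.state t₀‖₊ := fun u hur => by
      refine ih (S.erase (p.signal t)) ?_ ht₀ hur.1 (hdom u (ht₀.trans hur.1)
        (hur.2.le.trans hrt)) fun w hw => ?_
      · rw [Finset.card_erase_of_mem (hu t ⟨htt, le_rfl⟩), hS, Nat.add_sub_cancel]
      · have hwt : w ∈ Icc t₀ t := ⟨hw.1, hw.2.trans (hur.2.le.trans hrt)⟩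
        refine Finset.mem_erase.2 ⟨fun hw' => ?_, hu w hwt⟩
        exact (csInf_le hAbdd ⟨hwt, hw'⟩).not_gt (hw.2.trans_lt hur.2)
    have h₃ : Tendsto p.state (𝓝[<] r) (𝓝 (p.state r)) := by
      refine (p.continuousOn_Icc ht₀ (hdom r hr0 hrt) r ⟨ht₀r, le_rfl⟩).mono_left
        (nhdsWithin_le_of_mem ?_)
      exact mem_of_superset (Ico_mem_nhdsLT h) Ico_subset_Icc_self
    exact le_of_tendsto h₃.nnnorm (mem_of_superset (Ico_mem_nhdsLT h) h₂)

/-- Uniform stability from a weak Lyapunov-like function. -/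
theorem uniformlyStable (hf : ∀ γ, Continuous (f γ)) (hT : T' ⊆ coveringTrajectories f χ) :
    UniformlyStable T' := by
  obtain ⟨α₁, α₂, hα₁, hα₂, hbd⟩ := hV.bounds
  obtain ⟨β, hβ, hαβ⟩ := hα₁.exists_rightInverse
  -- `β ∘ α₂` converts the Lyapunov bounds into a norm bound; the summand `r` makes the function
  -- dominate the identity.
  have hα : IsClassKInfty fun r => r + β (α₂ r) :=
    isClassKInfty_id.add_monotone (hβ.strictMono.monotone.comp hα₂.strictMono.monotone)
      (hβ.continuous.comp hα₂.continuous) (by simp [hα₂.map_zero, hβ.map_zero])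
  have key : ∀ p ∈ T', ∀ t₀ t : ℝ, 0 ≤ t₀ → t₀ ≤ t → t ∈ p.dom →
      ‖p.state t‖₊ ≤ (fun r => r + β (α₂ r))^[m] ‖p.state t₀‖₊ := fun p hp t₀ t h₁ h₂ h₃ =>
    hV.nnnorm_state_le_iterate hχ hα₁ hbd hα.strictMono.monotone (fun r => le_self_add)
      (fun r => (hαβ (α₂ r)).symm.le.trans (hα₁.strictMono.monotone le_add_self)) hp (hT hp).2 m
      Finset.univ (Finset.card_fin m) h₁ h₂ h₃ fun u _ => Finset.mem_univ _
  refine ⟨_, hα.iterate m, fun p hp => ?_⟩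
  have hdom : p.dom = Ici 0 := by
    refine (hT hp).1.eq_Ici_of_bounded (R := (fun r => r + β (α₂ r))^[m] ‖p.state 0‖₊) hf
      p.isSwitchingSignal fun t ht => ?_
    exact_mod_cast key p hp 0 t le_rfl (p.isSolution.interval.nonneg ht) ht
  exact ⟨hdom, fun t₀ t h₁ h₂ => key p hp t₀ t h₁ h₂ (hdom ▸ h₁.trans h₂)⟩

end IsWeakLyapunovLike

end Lyapunov

/-! ### Uniform attractivity -/

section Attractivity

variable {n m : ℕ}

/-- Along solutions that stay in a compact annulus, a Lyapunov function with a small-time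
distinguishable dissipation rate decreases at least by a fixed amount in a given time. -/
theorem exists_pos_decrease {g : EuclideanSpace ℝ (Fin n) → EuclideanSpace ℝ (Fin n)}
    (hg : Continuous g) {w v : EuclideanSpace ℝ (Fin n) → ℝ} (hw : Continuous w)
    (hw0 : ∀ ξ, 0 ≤ w ξ) (hv : ContDiff ℝ 1 v) {C : Set (EuclideanSpace ℝ (Fin n))}
    (hC : IsClosed C) (hvw : ∀ ξ ∈ C, fderiv ℝ v ξ (g ξ) ≤ -w ξ)
    (hd : ZeroSmallTimeDistinguishable g w) {τ δ : ℝ} (hτ : 0 < τ) (hδ : 0 < δ) (R : ℝ) :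
    ∃ c > 0, ∀ (x : ℝ → EuclideanSpace ℝ (Fin n)) (b : ℝ), ContinuousOn x (Icc b (b + τ)) →
      (∀ t ∈ Ioo b (b + τ), HasDerivAt x (g (x t)) t) →
      (∀ t ∈ Icc b (b + τ), x t ∈ C ∧ δ ≤ ‖x t‖ ∧ ‖x t‖ ≤ R) → v (x (b + τ)) + c ≤ v (x b) := by
  -- Otherwise there are solutions with decrease less than `1 / (k + 1)`. Shifted to `[0, τ]`, a
  -- subsequence converges to a solution `y` in `C` with `δ ≤ ‖y 0‖`, along which `v` is constant;
  -- hence `w` vanishes along `y`.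
  by_contra! hcon
  choose z b hzc hzd hz hlt using fun k : ℕ => hcon (1 / ((k : ℝ) + 1)) (by positivity)
  let x : ℕ → ℝ → EuclideanSpace ℝ (Fin n) := fun k t => z k (b k + t)
  have hshift : ∀ k, ∀ t ∈ Icc 0 τ, b k + t ∈ Icc (b k) (b k + τ) := fun k t ht =>
    ⟨by linarith [ht.1], by linarith [ht.2]⟩
  have hxc : ∀ k, ContinuousOn (x k) (Icc 0 τ) := fun k =>
    (hzc k).comp (by fun_prop) fun t ht => hshift k t ht
  have hxd : ∀ k, ∀ t ∈ Ioo 0 τ, HasDerivAt (x k) (g (x k t)) t := fun k t ht =>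
    (hzd k (b k + t) ⟨by linarith [ht.1], by linarith [ht.2]⟩).comp_const_add (b k) t
  have hx : ∀ k, ∀ t ∈ Icc 0 τ, x k t ∈ C ∧ δ ≤ ‖x k t‖ ∧ ‖x k t‖ ≤ R := fun k t ht =>
    hz k _ (hshift k t ht)
  obtain ⟨M, hM⟩ := (isCompact_closedBall (0 : EuclideanSpace ℝ (Fin n))
    R).exists_bound_of_continuousOn hg.continuousOn
  have hu : TendstoUniformlyOn (fun _ : ℕ => g) g atTop (Metric.closedBall 0 R) := by
    rw [Metric.tendstoUniformlyOn_iff]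
    intro ε hε
    exact Eventually.of_forall fun _ _ _ => by simpa using hε
  obtain ⟨φ, y, hφ, hyc, hlim, hyd⟩ := exists_subseq_hasDerivAt (M := M.toNNReal) hg hτ hu
    (fun _ ξ hξ => (hM ξ hξ).trans (Real.le_coe_toNNReal M)) hxc (fun k t ht => (hx k t ht).2.2) hxd
  have hyC : ∀ t ∈ Icc 0 τ, y t ∈ C := fun t ht =>
    hC.mem_of_tendsto (hlim t ht) (Eventually.of_forall fun k => (hx (φ k) t ht).1)
  have hyδ : δ ≤ ‖y 0‖ := ge_of_tendsto (hlim 0 (left_mem_Icc.2 hτ.le)).norm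
    (Eventually.of_forall fun k => (hx (φ k) 0 (left_mem_Icc.2 hτ.le)).2.1)
  have hanti := antitoneOn_comp_of_hasDerivAt hv hyc hyd fun t ht =>
    (hvw _ (hyC t (Ioo_subset_Icc_self ht))).trans (neg_nonpos.2 (hw0 _))
  have hend : v (y 0) ≤ v (y τ) := by
    have h₁ := (hv.continuous.tendsto _).comp (hlim 0 (left_mem_Icc.2 hτ.le))
    have h₂ := ((hv.continuous.tendsto _).comp (hlim τ (right_mem_Icc.2 hτ.le))).add
      (tendsto_one_div_add_atTop_nhds_zero_nat.comp hφ.tendsto_atTop)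
    rw [add_zero] at h₂
    refine le_of_tendsto_of_tendsto' h₁ h₂ fun k => ?_
    simpa [x] using (hlt (φ k)).le
  have hconst : ∀ t ∈ Icc 0 τ, v (y t) = v (y 0) := fun t ht =>
    le_antisymm (hanti (left_mem_Icc.2 hτ.le) ht ht.1)
      (hend.trans (hanti ht (right_mem_Icc.2 hτ.le) ht.2))
  have hw_zero : ∀ t ∈ Ioo 0 τ, w (y t) = 0 := fun t ht => by
    have h₁ : HasDerivAt (fun s => v (y s)) (fderiv ℝ v (y t) (g (y t))) t :=
      ((hv.differentiable one_ne_zero) (y t)).hasFDerivAt.comp_hasDerivAt t (hyd t ht)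
    have h₂ : HasDerivAt (fun s => v (y s)) 0 t := by
      refine (hasDerivAt_const t (v (y 0))).congr_of_eventuallyEq ?_
      filter_upwards [Icc_mem_nhds ht.1 ht.2] with s hs using hconst s hs
    have h₃ := hvw _ (hyC t (Ioo_subset_Icc_self ht))
    rw [h₁.unique h₂] at h₃
    linarith [hw0 (y t)]
  have hw_zero' : EqOn (fun t => w (y t)) (fun _ => 0) (Icc 0 τ) := by
    rw [← closure_Ioo hτ.ne]
    refine EqOn.of_subset_closure (s := Ioo 0 τ) hw_zero ?_ continuousOn_const subset_closure
      subset_rfl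
    rw [closure_Ioo hτ.ne]
    exact hw.comp_continuousOn hyc
  have hy0 := hd τ y hτ (hyc.mono Ico_subset_Icc_self) hyd
    fun t ht => hw_zero' (Ico_subset_Icc_self ht)
  rw [hy0, norm_zero] at hyδ
  exact hδ.not_ge hyδ

/-- Under an average dwell-time, every interval of length `τD` contains an interval of a fixed
length without switching times. -/
theorem HasAverageDwellTime.exists_forall_notMem_discontinuities {τD : ℝ} {N0 : ℕ}
    {σ : ℝ → Fin m} (h : HasAverageDwellTime τD N0 σ) (hσ : IsSwitchingSignal σ) (hτD : 0 < τD)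
    {a : ℝ} (ha : 0 ≤ a) :
    ∃ b, a ≤ b ∧ b + τD / (N0 + 2) ≤ a + τD ∧
      ∀ t ∈ Ioo b (b + τD / (N0 + 2)), t ∉ discontinuities σ := by
  -- A window of length `τD` contains at most `N0 + 1` switching times, so one of `N0 + 2` disjoint
  -- open subintervals is free of them.
  set τ : ℝ := τD / (N0 + 2)
  have hτ : 0 < τ := by positivity
  have hττ : (N0 + 2) * τ = τD := by
    simp only [τ]
    field_simp
  by_contra! hcon
  have hle : ∀ i : Fin (N0 + 2), a + i * τ + τ ≤ a + τD := fun i => by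
    have h₁ : ((i : ℕ) : ℝ) + 1 ≤ N0 + 2 := by exact_mod_cast i.2
    nlinarith
  have hge : ∀ i : Fin (N0 + 2), a ≤ a + i * τ := fun i => by
    have : 0 ≤ ((i : ℕ) : ℝ) * τ := by positivity
    linarith
  choose u hu hud using fun i : Fin (N0 + 2) => hcon (a + i * τ) (hge i) (hle i)
  have hinj : StrictMono u := by
    intro i j hij
    have h₁ : ((i : ℕ) : ℝ) + 1 ≤ (j : ℕ) := by exact_mod_cast hij
    nlinarith [(hu i).2, (hu j).1]
  have hsub : range u ⊆ switchingTimes σ ∩ Ioo a (a + τD) := by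
    rintro _ ⟨i, rfl⟩
    exact ⟨mem_insert_of_mem _ (hud i), (hge i).trans_lt (hu i).1, (hu i).2.trans_le (hle i)⟩
  have hfin : (switchingTimes σ ∩ Ioo a (a + τD)).Finite :=
    (hσ.finite_switchingTimes_inter_Iic (a + τD)).subset fun t ht => ⟨ht.1, ht.2.2.le⟩
  have hcard : N0 + 2 ≤ (switchingTimes σ ∩ Ioo a (a + τD)).ncard := by
    have h₁ := ncard_le_ncard hsub hfin
    rwa [ncard_range_of_injective hinj.injective, Nat.card_fin] at h₁
  have h₁ := h a (a + τD) ha (by linarith)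
  rw [add_sub_cancel_left, div_self hτD.ne'] at h₁
  have h₂ : ((N0 + 2 : ℕ) : ℝ) ≤ N0 + 1 := le_trans (by exact_mod_cast hcard) h₁
  push_cast at h₂
  linarith

variable {f : Fin m → EuclideanSpace ℝ (Fin n) → EuclideanSpace ℝ (Fin n)}
  {χ : Fin m → Set (EuclideanSpace ℝ (Fin n))} {T' : Set (Trajectory f)}
  {V : EuclideanSpace ℝ (Fin n) → Fin m → ℝ}

/-- All trajectories that start in the ball of radius `R` enter the ball of radius `δ` before a
common time. -/
theorem IsWeakLyapunovLike.exists_time_norm_lt (hf : ∀ γ, Continuous (f γ))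
    (hχ : ∀ γ, IsClosed (χ γ)) (hV : IsWeakLyapunovLike χ T' V)
    (hT : T' ⊆ coveringTrajectories f χ)
    {W : Fin m → EuclideanSpace ℝ (Fin n) → ℝ} (hWc : ∀ γ, Continuous (W γ))
    (hW0 : ∀ γ ξ, 0 ≤ W γ ξ)
    (hVW : ∀ γ, ∀ ξ ∈ χ γ, fderiv ℝ (fun η => V η γ) ξ (f γ ξ) ≤ -W γ ξ)
    (hdist : ∀ γ, ZeroSmallTimeDistinguishable (f γ) (W γ)) {τD : ℝ} {N0 : ℕ} (hτD : 0 < τD)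
    (hTa : T' ⊆ dwellTrajectories f τD N0) {δ : ℝ} (hδ : 0 < δ) (R : ℝ) :
    ∃ T : ℝ, ∀ p ∈ T', p.dom = Ici 0 → ∀ t₀, 0 ≤ t₀ → (∀ t, t₀ ≤ t → ‖p.state t‖ ≤ R) →
      ∃ t, t₀ ≤ t ∧ t ≤ t₀ + T ∧ ‖p.state t‖ < δ := by
  obtain ⟨α₁, α₂, -, hα₂, hbd⟩ := hV.bounds
  set τ : ℝ := τD / (N0 + 2)
  have hτ : 0 < τ := by positivity
  choose c₀ hc₀ hdec₀ using fun γ => exists_pos_decrease (hf γ) (hWc γ) (hW0 γ)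
    (hV.contDiff γ) (hχ γ) (hVW γ) (hdist γ) hτ hδ R
  -- A common bound exists as there are finitely many modes; the filter argument also covers `m =
  -- 0`.
  obtain ⟨c, hc, hcc⟩ : ∃ c > 0, ∀ γ, c ≤ c₀ γ := by
    have h₁ : ∀ᶠ c in 𝓝[>] (0 : ℝ), ∀ γ, c ≤ c₀ γ := eventually_all.2 fun γ =>
      nhdsWithin_le_nhds (Iic_mem_nhds (hc₀ γ))
    obtain ⟨c, hc, hc'⟩ := (h₁.and self_mem_nhdsWithin).exists
    exact ⟨c, hc', hc⟩
  set A : ℝ := NNReal.toReal (α₂ R.toNNReal)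
  -- Each of `N` windows costs its mode an amount `c`, and a mode starts with at most `A` to lose;
  -- more than `m * A / c` windows are impossible.
  obtain ⟨N, hN⟩ := exists_nat_gt (m * A / c)
  refine ⟨N * τD, fun p hp hdom t₀ ht₀ hR => ?_⟩
  by_contra! hcon
  have hp' := (hT hp).2
  choose b hab hbb hbd' using fun i : ℕ =>
    (hTa hp).2.exists_forall_notMem_discontinuities p.isSwitchingSignal hτD
      (a := t₀ + i * τD) (by positivity)
  have hmem : ∀ t, t₀ ≤ t → t ∈ p.dom := fun t ht => hdom ▸ ht₀.trans ht
  have htb : ∀ i, t₀ ≤ b i := fun i =>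
    le_trans (by linarith [show 0 ≤ (i : ℝ) * τD by positivity]) (hab i)
  have hA : ∀ t, t₀ ≤ t → V (p.state t) (p.signal t) ≤ A := fun t ht => by
    refine (hbd _ _ (hp' t (hmem t ht))).2.trans ?_
    have : ‖p.state t‖₊ ≤ R.toNNReal := by
      rw [← norm_toNNReal]
      exact Real.toNNReal_le_toNNReal (hR t ht)
    exact_mod_cast hα₂.strictMono.monotone this
  have hdrop : ∀ i < N, V (p.state (b i + τ)) (p.signal (b i)) + c ≤
      V (p.state (b i)) (p.signal (b i)) := fun i hi => by
    have hi' : ((i : ℕ) : ℝ) + 1 ≤ N := by exact_mod_cast hi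
    have hbτ : b i + τ ∈ p.dom := hmem _ (by linarith [htb i])
    refine le_trans (by gcongr; exact hcc (p.signal (b i))) (hdec₀ (p.signal (b i)) p.state (b i)
      (p.continuousOn_Icc (ht₀.trans (htb i)) hbτ)
      (fun t ht => p.hasDerivAt (ht₀.trans (htb i)) hbτ (hbd' i) ht) fun t ht => ?_)
    have ht₀t : t₀ ≤ t := (htb i).trans ht.1
    refine ⟨p.state_mem hχ hp' (ht₀.trans (htb i)) hbτ (hbd' i) ht, hcon t ht₀t ?_, hR t ht₀t⟩
    have := hbb i
    nlinarith [ht.2]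
  -- Bookkeeping per mode: whenever `γ` is active after the first `k` windows, its Lyapunov value
  -- has paid `c` for each of these windows assigned to it.
  have hcount : ∀ k ≤ N, ∀ γ t, t₀ + k * τD ≤ t → p.signal t = γ →
      V (p.state t) γ + c * ((Finset.range k).filter fun i => p.signal (b i) = γ).card ≤ A := by
    intro k
    induction k with
    | zero =>
      rintro - γ t ht rfl
      simpa using hA t (by simpa using ht)
    | succ k ih =>
      intro hk γ t ht hγ
      push_cast at ht
      rw [Finset.range_add_one, Finset.filter_insert]
      split_ifs with hkγ
      · rw [Finset.card_insert_of_notMem (by simp)]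
        have h₁ := ih (by omega) γ (b k) (hab k) hkγ
        have h₂ := hdrop k (by omega)
        have h₃ := hV.le_of_signal_eq hχ hp hp' (ht₀.trans (htb k))
          (le_add_of_nonneg_right hτ.le) (b := t) (by linarith [hbb k])
          (hmem t (by nlinarith [show 0 ≤ (k : ℝ) * τD by positivity])) (hbd' k) (hγ.trans hkγ.symm)
        rw [hkγ] at h₂ h₃
        push_cast
        linarith
      · exact ih (by omega) γ t (by linarith) hγ
  -- The same budget without a later activation of `γ`: nonnegativity of its Lyapunov function is
  -- used at the end of the last interval assigned to it.
  have hcount' : ∀ k ≤ N, ∀ γ,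
      c * ((Finset.range k).filter fun i => p.signal (b i) = γ).card ≤ A := by
    intro k
    induction k with
    | zero =>
      intro _ γ
      simp [A]
    | succ k ih =>
      intro hk γ
      rw [Finset.range_add_one, Finset.filter_insert]
      split_ifs with hkγ
      · rw [Finset.card_insert_of_notMem (by simp)]
        have h₁ := hcount k (by omega) γ (b k) (hab k) hkγ
        have h₂ := hdrop k (by omega)
        have h₃ := hV.nonneg (p.state_mem hχ hp' (ht₀.trans (htb k))
          (hmem (b k + τ) (by linarith [htb k])) (hbd' k) ⟨by linarith, le_rfl⟩)
        rw [hkγ] at h₂ h₃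
        push_cast
        linarith
      · exact ih (by omega) γ
  have hsum : ∑ γ, ((Finset.range N).filter fun i => p.signal (b i) = γ).card = N := by
    rw [← Finset.card_eq_sum_card_fiberwise (fun _ _ => Finset.mem_univ _), Finset.card_range]
  have h₁ : c * N ≤ m * A := by
    rw [← hsum]
    push_cast
    rw [Finset.mul_sum]
    exact (Finset.sum_le_sum fun γ _ => hcount' N le_rfl γ).trans (by simp)
  rw [div_lt_iff₀ hc] at hN
  linarith

end Attractivity

/-! ### Domination by a function of class `𝒦ℒ` -/

section Majorant

/-- The mean of a monotone `h` over `[r, 2r]`, here written over `u ∈ [1, 2]`, lies between `h r`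
and `h (2r)`. It serves as a regularisation of `h` that stays above it. -/
theorem le_integral_comp_mul {h : ℝ → ℝ} (hh : Monotone h) {r : ℝ} (hr : 0 ≤ r) :
    h r ≤ ∫ u in (1 : ℝ)..2, h (r * u) := by
  have hm : Monotone fun u => h (r * u) := fun u v huv => hh (by gcongr)
  have h₁ := intervalIntegral.integral_mono_on (μ := MeasureTheory.volume) (one_le_two (α := ℝ))
    (f := fun _ => h r) (g := fun u => h (r * u)) (by simp) hm.intervalIntegrable
    fun u hu => hh (le_mul_of_one_le_right hr hu.1)
  simpa [show (2 : ℝ) - 1 = 1 by norm_num] using h₁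

theorem integral_comp_mul_le {h : ℝ → ℝ} (hh : Monotone h) {r : ℝ} (hr : 0 ≤ r) :
    ∫ u in (1 : ℝ)..2, h (r * u) ≤ h (r * 2) := by
  have hm : Monotone fun u => h (r * u) := fun u v huv => hh (by gcongr)
  have h₁ := intervalIntegral.integral_mono_on (μ := MeasureTheory.volume) (one_le_two (α := ℝ))
    (f := fun u => h (r * u)) (g := fun _ => h (r * 2)) hm.intervalIntegrable (by simp)
    fun u hu => hm hu.2
  simpa [show (2 : ℝ) - 1 = 1 by norm_num] using h₁

theorem integral_comp_mul_mono {h : ℝ → ℝ} (hh : Monotone h) {r s : ℝ} (hr : 0 ≤ r)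
    (hrs : r ≤ s) : ∫ u in (1 : ℝ)..2, h (r * u) ≤ ∫ u in (1 : ℝ)..2, h (s * u) := by
  have hm : ∀ r, 0 ≤ r → Monotone fun u => h (r * u) := fun r hr u v huv => hh (by gcongr)
  refine intervalIntegral.integral_mono_on one_le_two (hm r hr).intervalIntegrable
    (hm s (hr.trans hrs)).intervalIntegrable fun u hu => hh ?_
  have : 0 ≤ u := zero_le_one.trans hu.1
  gcongr

/-- Substituting `v = r * u` gives `r⁻¹` times a difference of primitives, which are continuous even
where `h` jumps. -/
theorem continuousAt_integral_comp_mul {h : ℝ → ℝ} (hh : Monotone h) {r : ℝ} (hr : 0 < r) :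
    ContinuousAt (fun r => ∫ u in (1 : ℝ)..2, h (r * u)) r := by
  have hint : ∀ a b, IntervalIntegrable h MeasureTheory.volume a b := fun a b =>
    hh.intervalIntegrable
  have hP := intervalIntegral.continuous_primitive hint 0
  have hcont : ContinuousAt (fun r : ℝ =>
      r⁻¹ * ((∫ v in (0 : ℝ)..(r * 2), h v) - ∫ v in (0 : ℝ)..(r * 1), h v)) r := by
    refine (continuousAt_inv₀ hr.ne').mul (Continuous.continuousAt ?_)
    exact (hP.comp (continuous_mul_const 2)).sub (hP.comp (continuous_mul_const 1))
  refine hcont.congr ?_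
  filter_upwards [Ioi_mem_nhds hr] with s hs
  rw [intervalIntegral.integral_comp_mul_left _ (ne_of_gt hs), smul_eq_mul,
    intervalIntegral.integral_interval_sub_left (hint _ _) (hint _ _)]

/-- A function of two variables that is monotone in the first one, dominated by a function of class
`𝒦_∞`, and decreases to zero in the second one, is dominated by a function of class `𝒦ℒ`. -/
theorem exists_isClassKL_of_monotone {α : ℝ≥0 → ℝ≥0} (hα : IsClassKInfty α) {ψ : ℝ → ℝ≥0 → ℝ}
    (h0 : ∀ r t, 0 ≤ ψ r t) (hmono : ∀ t, Monotone fun r => ψ r t) (hanti : ∀ r, Antitone (ψ r))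
    (hle : ∀ r t, ψ r t ≤ α r.toNNReal) (hlim : ∀ r, Tendsto (ψ r) atTop (𝓝 0)) :
    ∃ β, IsClassKL β ∧ ∀ r t : ℝ≥0, ψ r t ≤ β r t := by
  let F : ℝ → ℝ≥0 → ℝ := fun r t => ∫ u in (1 : ℝ)..2, ψ (r * u) t
  have hF0 : ∀ (r : ℝ≥0) t, 0 ≤ F r t := fun r t =>
    (h0 r t).trans (le_integral_comp_mul (hmono t) r.coe_nonneg)
  have hFanti : ∀ r : ℝ≥0, Antitone (F r) := fun r s t hst => by
    have hm : ∀ t, Monotone fun u => ψ (r * u) t := fun t u v huv => hmono t (by gcongr)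
    exact intervalIntegral.integral_mono_on one_le_two (hm t).intervalIntegrable
      (hm s).intervalIntegrable fun u _ => hanti _ hst
  have hFlim : ∀ r : ℝ≥0, Tendsto (F r) atTop (𝓝 0) := fun r =>
    squeeze_zero (hF0 r) (fun t => integral_comp_mul_le (hmono t) r.coe_nonneg) (hlim _)
  have hFz : ∀ t, F (0 : ℝ≥0) t = 0 := fun t => by
    refine le_antisymm ((integral_comp_mul_le (hmono t) (0 : ℝ≥0).coe_nonneg).trans
      ((hle _ t).trans ?_)) (hF0 0 t)
    simp [hα.map_zero]
  have hFcont : ∀ t, Continuous fun r : ℝ≥0 => F r t := fun t => by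
    rw [continuous_iff_continuousAt]
    intro r
    rcases (zero_le : 0 ≤ r).eq_or_lt with rfl | hr
    -- At `r = 0` the substitution is not available; continuity comes from the bound `α (2r)`.
    · rw [ContinuousAt, hFz]
      have h₁ : Tendsto (fun r : ℝ≥0 => ((α (r * 2) : ℝ≥0) : ℝ)) (𝓝 0) (𝓝 0) := by
        have : Continuous fun r : ℝ≥0 => ((α (r * 2) : ℝ≥0) : ℝ) :=
          NNReal.continuous_coe.comp (hα.continuous.comp (continuous_mul_const 2))
        simpa [hα.map_zero] using this.tendsto 0
      refine squeeze_zero (fun r => hF0 r t) (fun r => ?_) h₁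
      refine (integral_comp_mul_le (hmono t) r.coe_nonneg).trans ((hle _ t).trans (le_of_eq ?_))
      congr 2
      rw [Real.toNNReal_mul r.coe_nonneg, Real.toNNReal_coe, Real.toNNReal_ofNat]
    · exact ContinuousAt.comp (f := fun r : ℝ≥0 => (r : ℝ)) (g := fun r => F r t)
        (continuousAt_integral_comp_mul (hmono t) (NNReal.coe_pos.2 hr))
        NNReal.continuous_coe.continuousAt
  -- The mean is only monotone in `r` and may be bounded; `r / (1 + t)` adds strict growth and
  -- unboundedness and still decays in `t`.
  refine ⟨fun r t => r / (1 + t) + (F r t).toNNReal, ⟨fun t => ?_, fun r s t hst => ?_, fun r => ?_⟩,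
    fun r t => ?_⟩
  · refine IsClassKInfty.add_monotone (α := fun r => r / (1 + t)) ?_ (fun r s hrs => ?_) ?_ ?_
    · have ht : 0 < 1 + t := by positivity
      refine ⟨fun r s hrs => ?_, by fun_prop, by simp, fun M => ⟨(M + 1) * (1 + t), ?_⟩⟩
      · exact div_lt_div_of_pos_right hrs ht
      · rw [mul_div_cancel_right₀ _ ht.ne']
        exact lt_add_one M
    · exact Real.toNNReal_le_toNNReal (integral_comp_mul_mono (hmono t) r.coe_nonneg hrs)
    · exact continuous_real_toNNReal.comp (hFcont t)
    · rw [hFz, Real.toNNReal_zero]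
  · exact add_le_add (by gcongr) (Real.toNNReal_le_toNNReal (hFanti r hst))
  · have h₁ : Tendsto (fun t : ℝ≥0 => r / (1 + t)) atTop (𝓝 0) := by
      rw [← NNReal.tendsto_coe]
      push_cast
      exact Tendsto.const_div_atTop (tendsto_atTop_add_const_left _ _
        (NNReal.tendsto_coe_atTop.2 tendsto_id)) (r : ℝ)
    have h₂ := (continuous_real_toNNReal.tendsto 0).comp (hFlim r)
    rw [Real.toNNReal_zero] at h₂
    simpa using h₁.add h₂
  · refine (le_integral_comp_mul (hmono t) r.coe_nonneg).trans ((Real.le_coe_toNNReal _).trans ?_)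
    exact_mod_cast le_add_self

end Majorant

/-! ### From stability and attractivity to the `𝒦ℒ` estimate -/

section Conclusion

variable {n m : ℕ} {f : Fin m → EuclideanSpace ℝ (Fin n) → EuclideanSpace ℝ (Fin n)}
  {T' : Set (Trajectory f)}

/-- Uniform stability and uniform attractivity imply a `𝒦ℒ` estimate. -/
theorem UniformlyStable.globallyUniformlyAsymptoticallyStable (hT : UniformlyStable T')
    (hatt : ∀ r ε : ℝ, 0 < ε → ∃ T : ℝ, ∀ p ∈ T', ∀ t₀ t : ℝ, 0 ≤ t₀ → t₀ ≤ t → t₀ + T ≤ t →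
      ‖p.state t₀‖ ≤ r → ‖p.state t‖ ≤ ε) :
    GloballyUniformlyAsymptoticallyStable T' := by
  obtain ⟨α, hα, hdom⟩ := hT
  -- Taking all elapsed times `s ≥ t` and all starts in the ball of radius `r` makes the supremum
  -- monotone in both arguments; `0` is inserted to keep the set nonempty.
  let S : ℝ → ℝ≥0 → Set ℝ := fun r t => insert 0 {y | ∃ p ∈ T', ∃ t₀ s : ℝ, 0 ≤ t₀ ∧ (t : ℝ) ≤ s ∧
    ‖p.state t₀‖ ≤ r ∧ ‖p.state (t₀ + s)‖ = y}
  have hSα : ∀ r t, ∀ y ∈ S r t, y ≤ α r.toNNReal := by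
    rintro r t y (rfl | ⟨p, hp, t₀, s, ht₀, hts, hr, rfl⟩)
    · exact NNReal.coe_nonneg _
    · have hs : 0 ≤ s := t.coe_nonneg.trans hts
      have h₁ := (hdom p hp).2 t₀ (t₀ + s) ht₀ (by linarith)
      have h₂ : ‖p.state t₀‖₊ ≤ r.toNNReal := by
        rw [← norm_toNNReal]
        exact Real.toNNReal_le_toNNReal hr
      exact_mod_cast h₁.trans (hα.strictMono.monotone h₂)
  have hSbdd : ∀ r t, BddAbove (S r t) := fun r t => ⟨_, hSα r t⟩
  have hSne : ∀ r t, (S r t).Nonempty := fun r t => ⟨0, mem_insert _ _⟩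
  obtain ⟨β, hβ, hψβ⟩ := exists_isClassKL_of_monotone hα (ψ := fun r t => sSup (S r t))
    (fun r t => le_csSup (hSbdd r t) (mem_insert _ _))
    (fun t r r' hrr' => csSup_le_csSup (hSbdd _ _) (hSne _ _) <| insert_subset_insert <| by
      rintro y ⟨p, hp, t₀, s, h₁, h₂, h₃, h₄⟩
      exact ⟨p, hp, t₀, s, h₁, h₂, h₃.trans hrr', h₄⟩)
    (fun r t t' htt' => csSup_le_csSup (hSbdd _ _) (hSne _ _) <| insert_subset_insert <| by
      rintro y ⟨p, hp, t₀, s, h₁, h₂, h₃, h₄⟩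
      exact ⟨p, hp, t₀, s, h₁, (NNReal.coe_le_coe.2 htt').trans h₂, h₃, h₄⟩)
    (fun r t => csSup_le (hSne r t) (hSα r t))
    (fun r => by
      rw [Metric.tendsto_nhds]
      intro ε hε
      obtain ⟨T, hT⟩ := hatt r (ε / 2) (half_pos hε)
      filter_upwards [eventually_ge_atTop T.toNNReal] with t ht
      have h₁ : sSup (S r t) ≤ ε / 2 := by
        refine csSup_le (hSne r t) ?_
        rintro y (rfl | ⟨p, hp, t₀, s, ht₀, hts, hr, rfl⟩)
        · exact (half_pos hε).le
        · have hs : 0 ≤ s := t.coe_nonneg.trans hts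
          have hTs : T ≤ s := (Real.toNNReal_le_iff_le_coe.1 ht).trans hts
          exact hT p hp t₀ (t₀ + s) ht₀ (by linarith) (by linarith) hr
      have h₂ : 0 ≤ sSup (S r t) := le_csSup (hSbdd r t) (mem_insert _ _)
      rw [Real.dist_eq, sub_zero, abs_of_nonneg h₂]
      linarith)
  refine ⟨β, hβ, fun p hp => ⟨(hdom p hp).1, fun t₀ t ht₀ htt => ?_⟩⟩
  have h₁ : ‖p.state t‖ ≤ sSup (S ‖p.state t₀‖₊ (t - t₀).toNNReal) :=
    le_csSup (hSbdd _ _) (mem_insert_of_mem _ ⟨p, hp, t₀, t - t₀, ht₀,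
      (Real.coe_toNNReal _ (sub_nonneg.2 htt)).le, le_rfl, by rw [add_sub_cancel]⟩)
  exact_mod_cast h₁.trans (hψβ _ _)

theorem GloballyUniformlyAsymptoticallyStable.tendsto_zero
    (h : GloballyUniformlyAsymptoticallyStable T') {p : Trajectory f} (hp : p ∈ T') :
    Tendsto p.state atTop (𝓝 0) := by
  obtain ⟨β, hβ, hβT⟩ := h
  have h₁ : Tendsto (fun t : ℝ => ((β ‖p.state 0‖₊ t.toNNReal : ℝ≥0) : ℝ)) atTop (𝓝 0) := by
    have := (NNReal.tendsto_coe.2 (hβ.right_tendsto ‖p.state 0‖₊)).comp tendsto_real_toNNReal_atTop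
    exact this
  refine squeeze_zero_norm' ?_ h₁
  filter_upwards [eventually_ge_atTop 0] with t ht
  have h₂ := (hβT p hp).2 0 t le_rfl ht
  rw [sub_zero] at h₂
  exact_mod_cast h₂

variable {χ : Fin m → Set (EuclideanSpace ℝ (Fin n))} {V : EuclideanSpace ℝ (Fin n) → Fin m → ℝ}

/-- Within a uniform time the state enters a ball so small that uniform stability confines it to
radius `ε` from then on. -/
theorem IsWeakLyapunovLike.globallyUniformlyAsymptoticallyStable (hf : ∀ γ, Continuous (f γ))
    (hχ : ∀ γ, IsClosed (χ γ)) (hV : IsWeakLyapunovLike χ T' V)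
    (hT : T' ⊆ coveringTrajectories f χ)
    {W : Fin m → EuclideanSpace ℝ (Fin n) → ℝ} (hWc : ∀ γ, Continuous (W γ))
    (hW0 : ∀ γ ξ, 0 ≤ W γ ξ)
    (hVW : ∀ γ, ∀ ξ ∈ χ γ, fderiv ℝ (fun η => V η γ) ξ (f γ ξ) ≤ -W γ ξ)
    (hdist : ∀ γ, ZeroSmallTimeDistinguishable (f γ) (W γ)) {τD : ℝ} {N0 : ℕ} (hτD : 0 < τD)
    (hTa : T' ⊆ dwellTrajectories f τD N0) : GloballyUniformlyAsymptoticallyStable T' := by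
  have hus := hV.uniformlyStable hχ hf hT
  refine hus.globallyUniformlyAsymptoticallyStable fun r ε hε => ?_
  obtain ⟨α, hα, hαT⟩ := hus
  obtain ⟨β, hβ, hαβ⟩ := hα.exists_rightInverse
  have hδ : 0 < β ε.toNNReal := by
    rw [← hβ.map_zero]
    exact hβ.strictMono (Real.toNNReal_pos.2 hε)
  obtain ⟨T, hTT⟩ := hV.exists_time_norm_lt hf hχ hT hWc hW0 hVW hdist hτD hTa
    (NNReal.coe_pos.2 hδ) (α r.toNNReal)
  refine ⟨T, fun p hp t₀ t ht₀ htt hTt hr => ?_⟩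
  obtain ⟨s, hs, hsT, hsδ⟩ := hTT p hp (hαT p hp).1 t₀ ht₀ fun u hu => by
    have h₁ : ‖p.state t₀‖₊ ≤ r.toNNReal := by
      rw [← norm_toNNReal]
      exact Real.toNNReal_le_toNNReal hr
    exact_mod_cast ((hαT p hp).2 t₀ u ht₀ hu).trans (hα.strictMono.monotone h₁)
  have h₁ := (hαT p hp).2 s t (ht₀.trans hs) (hsT.trans hTt)
  have h₂ : α ‖p.state s‖₊ ≤ ε.toNNReal := by
    rw [← hαβ ε.toNNReal]
    exact hα.strictMono.monotone (by exact_mod_cast hsδ.le)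
  rw [← Real.coe_toNNReal ε hε.le]
  exact_mod_cast h₁.trans h₂

end Conclusion

end SwitchedSystem

theorem theorem3 {n m : ℕ}
    (f : Fin m → EuclideanSpace ℝ (Fin n) → EuclideanSpace ℝ (Fin n))
    (hf : ∀ γ, Continuous (f γ))
    (χ : Fin m → Set (EuclideanSpace ℝ (Fin n)))
    (hχ : SwitchedSystem.IsClosedCovering χ)
    (hf0 : ∀ γ, (0 : EuclideanSpace ℝ (Fin n)) ∈ χ γ → f γ 0 = 0)
    (T' : Set (SwitchedSystem.Trajectory f))
    (hTχ : T' ⊆ SwitchedSystem.coveringTrajectories f χ)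
    (hTa : T' ⊆ SwitchedSystem.averageDwellTrajectories f)
    (V : EuclideanSpace ℝ (Fin n) → Fin m → ℝ)
    (hV : SwitchedSystem.IsWeakLyapunovLike χ T' V)
    (W : Fin m → EuclideanSpace ℝ (Fin n) → ℝ)
    (hWcont : ∀ γ, Continuous (W γ))
    (hWnonneg : ∀ γ ξ, 0 ≤ W γ ξ)
    (hVW : ∀ γ, ∀ ξ ∈ χ γ, fderiv ℝ (fun η => V η γ) ξ (f γ ξ) ≤ -W γ ξ)
    (hdist : ∀ γ, SwitchedSystem.ZeroSmallTimeDistinguishable (f γ) (W γ)) :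
    SwitchedSystem.GloballyAsymptoticallyStable T' ∧
      ((∃ (τD : ℝ) (N0 : ℕ), 0 < τD ∧ T' ⊆ SwitchedSystem.dwellTrajectories f τD N0) →
        SwitchedSystem.GloballyUniformlyAsymptoticallyStable T') := by
  refine ⟨⟨hV.uniformlyStable hχ.closed hf hTχ, fun p hp => ?_⟩, ?_⟩
  -- The dwell constants depend on `p`, so the uniform statement is applied to the family `{p}`, for
  -- which `V` is still weak Lyapunov-like.
  · obtain ⟨τD, N0, hτD, -, hpa⟩ := hTa hp
    have hsub : {p} ⊆ T' := singleton_subset_iff.2 hp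
    exact ((hV.mono hsub).globallyUniformlyAsymptoticallyStable hf hχ.closed (hsub.trans hTχ)
      hWcont hWnonneg hVW hdist hτD (singleton_subset_iff.2 hpa)).tendsto_zero (mem_singleton p)
  · rintro ⟨τD, N0, hτD, hTd⟩
    exact hV.globallyUniformlyAsymptoticallyStable hf hχ.closed hTχ hWcont hWnonneg hVW hdist
      hτD hTd
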